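/- **Conventions.** A local field $K$ is a nonarchimedean local field, with absolute Galois group $G_K$, inertia subgroup $I_K$ and residue field of size $q_K$. All homomorphisms from Galois groups to finite groups are continuous. Let $\Gamma$ be a finite group acting on a finite set $X$. A *counting function* $c$ for $\Gamma$ assigns to each homomorphism $\rho:G_K\to\Gamma$, $K$ any local field, an integer $c(\rho)\ge 0$, such that $c(\gamma\rho\gamma^{-1})=c(\rho)$ for $\gamma\in\Gamma$ and such that $c$ is compatible with isomorphisms of local fields. If the orbits of $\rho(G_K)$ on $X$ are $m_1,\dots,m_r$ and $m_i$ breaks up into $f_i$ orbits of size $e_i$ under $\rho(I_K)$, then $\rho$ has *type* $(f_1^{e_1}\cdots f_r^{e_r})$ (an unordered collection of symbols). Let $S$ be a class of local fields. $(\Gamma,c)$ has *mass formulas for $S$ by type* if for every type $\sigma$ there is $f_{(\Gamma,c,\sigma)}\in\mathbb Z[x]$ such that for all $K\in S$ the sum on the left converges and $$\sum_{\rho:G_K\to\Gamma\text{ of type }\sigma} q_K^{-c(\rho)}=f_{(\Gamma,c,\sigma)}(1/q_K).$$ **Theorem.** Let $A$ and $B$ be finite groups acting on finite sets $\mathcal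 A$ and $\mathcal B$, with counting functions $c_A$, $c_B$, and suppose that $(A,c_A)$ and $(B,c_B)$ have mass formulas for $S$ by type. (1) *Wreath products.* Fix a total order on $\mathcal B$, and let $A\wr B=A^{\mathcal B}\rtimes B$ act on $\mathcal B\times\mathcal A$, the disjoint union of copies of $\mathcal A$ indexed by $\mathcal B$. For $\rho:G_K\to A\wr B$ let $\bar\rho:G_K\to B$ be the quotient; for $j\in\mathcal B$ let $L_j$ be the fixed field of the stabilizer of $j$ in $G_K$, and $\rho_j:G_{L_j}\to A$ the action on the $j$-th copy of $\mathcal A$. Let $i$ run through the least elements of the orbits of $\bar\rho(G_K)$ on $\mathcal B$, and let $f_i^{e_i}$ be the symbol of the orbit of $i$. Then $$c(\rho)=c_B(\bar\rho)+\sum_i f_i\,c_A(\rho_i)$$ is a counting function for $A\wr B$. Suppose moreover that for all $K\in S$, all $\phi:G_K\to B$ and all $j\in\mathcal B$ the fixed field of the stabilizer of $j$ is in $S$ (for example, that $S$ is closed under finite separable extensions). Then $(A\wr B,c)$ has mass formulas for $S$ by type. More precisely, say that $\rho$ has *wreath type* $\Sigma=(f_1^{e_1}(\sigma_1)\cdots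 f_r^{e_r}(\sigma_r))$ if $\bar\rho$ has type $\sigma=(f_1^{e_1}\cdots f_r^{e_r})$ and, for every symbol $f^e$, the types of the $\rho_i$ with $f_i^{e_i}=f^e$, in increasing order of $i$, are the $\sigma_k$ with $f_k^{e_k}=f^e$, in increasing order of $k$. Then for every $\Sigma$, every $K\in S$ and every choice of the polynomials $f_{(A,c_A,\cdot)}$ and $f_{(B,c_B,\cdot)}$, the following sum converges and $$\sum_{\rho:G_K\to A\wr B\text{ of wreath type }\Sigma} q_K^{-c(\rho)}=|A|^{|\mathcal B|-r}\,f_{(B,c_B,\sigma)}(1/q_K)\prod_{k=1}^r f_{(A,c_A,\sigma_k)}\big(1/q_K^{f_k}\big).$$ (If $r>|\mathcal B|$, no $\rho$ has wreath type $\Sigma$ and both sides are $0$.) (2) *Direct products.* Let $A\times B$ act on the disjoint union $\mathcal A\sqcup\mathcal B$. Then $c''(\rho\times\rho')=c_A(\rho)+c_B(\rho')$ is a counting function for $A\times B$, and $(A\times B,c'')$ has mass formulas for $S$ by type. More precisely, for all types $\sigma,\sigma'$ and all $K\in S$, the following sum converges and $$\sum_{\rho\times\rho'\,:\ \rho\text{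 of type }\sigma,\ \rho'\text{ of type }\sigma'} q_K^{-c''(\rho\times\rho')}=f_{(A,c_A,\sigma)}(1/q_K)\,f_{(B,c_B,\sigma')}(1/q_K).$$ -/

import Mathlib

universe u

noncomputable section

namespace MassFormula

open scoped ValuativeRel

/-! ### Local fields, residue cardinality, inertia -/

/-- `K` is a (nonarchimedean) local field and `O` is its ring of integers.  A local field is recorded
as the pair `(K, O)`: the valuation (up to equivalence) and the topology are determined by `O`. -/
def IsLocalField (K : Type u) [Field K] (O : Subring K) : Prop :=
  ∃ (_ : ValuativeRel K) (_ : TopologicalSpace K),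
    IsNonarchimedeanLocalField K ∧ O = 𝒪[K]

/-- The cardinality `q_K` of the residue field of the local ring `O`
(whose Jacobson radical is its maximal ideal). -/
def residueCard {K : Type u} [Field K] (O : Subring K) : ℕ :=
  Nat.card (O ⧸ Ideal.jacobson (⊥ : Ideal O))

/-- The ring of integers of an extension `L` of `K`: the elements that are integral over `O`. -/
def integersIn {K : Type u} [Field K] (O : Subring K) (L : Type u) [Field L] [Algebra K L] :
    Subring L :=
  (integralClosure O L).toSubring

theorem map_mem_integersIn {K Ω : Type u} [Field K] [Field Ω] [Algebra K Ω] (O : Subring K)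
    (g : Gal(Ω/K)) {x : Ω} (hx : x ∈ integersIn O Ω) : g x ∈ integersIn O Ω :=
  IsIntegral.map (g.toAlgHom.restrictScalars O) hx

/-- The inertia group of `Gal(Ω/K)`: the automorphisms that act trivially on the residue field of
the ring of integers of `Ω` (a local ring when `Ω` is a separable closure of the local field
`K`, so that its Jacobson radical is its maximal ideal). -/
def inertia {K : Type u} [Field K] (O : Subring K) (Ω : Type u) [Field Ω] [Algebra K Ω] :
    Subgroup Gal(Ω/K) where
  carrier := {g | ∀ x ∈ integersIn O Ω,
    ∃ m ∈ Ideal.jacobson (⊥ : Ideal (integersIn O Ω)), (m : Ω) = g x - x}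
  one_mem' := fun x _ => ⟨0, Ideal.zero_mem _, by simp⟩
  mul_mem' := by
    intro g h hg hh x hx
    obtain ⟨m₁, hm₁, h₁⟩ := hg (h x) (map_mem_integersIn O h hx)
    obtain ⟨m₂, hm₂, h₂⟩ := hh x hx
    exact ⟨m₁ + m₂, Ideal.add_mem _ hm₁ hm₂, by simp [h₁, h₂]⟩
  inv_mem' := by
    intro g hg x hx
    obtain ⟨m, hm, h⟩ := hg (g⁻¹ x) (map_mem_integersIn O g⁻¹ hx)
    refine ⟨-m, (Ideal.neg_mem_iff _).2 hm, ?_⟩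
    have h' : g (g⁻¹ x) = x := g.apply_symm_apply x
    rw [h'] at h
    simp [h]

/-! ### Galois representations -/

/-- The set `S_{K,Γ}` of homomorphisms `Gal(Ω/K) → Γ` that are continuous for the Krull topology
and the discrete topology on `Γ`. -/
def Rep (K Ω Γ : Type*) [Field K] [Field Ω] [Algebra K Ω] [Group Γ] :=
  {ρ : Gal(Ω/K) →* Γ // @Continuous Gal(Ω/K) Γ (krullTopology K Ω) ⊥ ρ}

section Rep

variable {K Ω Γ Δ : Type*} [Field K] [Field Ω] [Algebra K Ω] [Group Γ] [Group Δ]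

theorem continuous_comp_discrete {G Γ Δ : Type*} [TopologicalSpace G] {ρ : G → Γ}
    (h : @Continuous G Γ _ ⊥ ρ) (φ : Γ → Δ) : @Continuous G Δ _ ⊥ fun g => φ (ρ g) := by
  let _ : TopologicalSpace Γ := ⊥
  let _ : TopologicalSpace Δ := ⊥
  have : DiscreteTopology Γ := ⟨rfl⟩
  exact (continuous_of_discreteTopology (f := φ)).comp h

/-- The composite of a representation with a homomorphism `Γ → Δ`. -/
def Rep.map (φ : Γ →* Δ) (ρ : Rep K Ω Γ) : Rep K Ω Δ :=
  ⟨φ.comp ρ.1, continuous_comp_discrete ρ.2 φ⟩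

/-- The representation `γ ρ γ⁻¹`. -/
def Rep.conj (γ : Γ) (ρ : Rep K Ω Γ) : Rep K Ω Γ :=
  ρ.map (MulAut.conj γ).toMonoidHom

/-- The stabilizer of the point `x` in the Galois group acting through `ρ`. -/
def Rep.stab {X : Type*} [MulAction Γ X] (ρ : Rep K Ω Γ) (x : X) : Subgroup Gal(Ω/K) :=
  (MulAction.stabilizer Γ x).comap ρ.1

/-- The fixed field of the stabilizer of the point `x`. -/
def Rep.pointField {X : Type*} [MulAction Γ X] (ρ : Rep K Ω Γ) (x : X) : IntermediateField K Ω :=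
  IntermediateField.fixedField (ρ.stab x)

end Rep

/-! ### Types -/

section Types

variable {K Ω : Type u} [Field K] [Field Ω] [Algebra K Ω] {Γ X : Type*} [Group Γ] [MulAction Γ X]

/-- The symbol `f^e`, recorded as the pair `(f, e)`, of the orbit of `x` under the Galois group:
this orbit breaks up into `f` orbits of size `e` under the inertia group. -/
def symbolAt (O : Subring K) (ρ : Rep K Ω Γ) (x : X) : ℕ × ℕ :=
  (((fun y : X => MulAction.orbit ((inertia O Ω).map ρ.1) y) ''
      (MulAction.orbit ρ.1.range x)).ncard,
    (MulAction.orbit ((inertia O Ω).map ρ.1) x).ncard)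

variable (X) in
open Classical in
/-- The type `(f₁^{e₁} ⋯ f_r^{e_r})` of a representation: the multiset of the symbols of its orbits
on `X`. -/
def repType [Fintype X] (O : Subring K) (ρ : Rep K Ω Γ) : Multiset (ℕ × ℕ) :=
  (Finset.univ : Finset (MulAction.orbitRel.Quotient ρ.1.range X)).val.map
    (fun o => symbolAt O ρ o.out)

end Types

/-! ### Counting functions and mass formulas by type -/

/-- Functions that assign a natural number to each representation into `Γ` of the
absolute Galois group (formed with an arbitrary separable closure) of each local field. -/
abbrev RepFunction (Γ : Type*) [Group Γ] :=
  ∀ (K Ω : Type u) [Field K] [Field Ω] [Algebra K Ω] [IsSepClosure K Ω] (_ : Subring K),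
    Rep K Ω Γ → ℕ

/-- `c` is a counting function for `Γ`: it is invariant under conjugation by `Γ`, and it only depends
on the isomorphism class of the local field (an isomorphism `e` of local fields together with
an extension `E` of it to the separable closures identifies the absolute Galois groups). -/
structure IsCountingFunction {Γ : Type*} [Group Γ] (c : RepFunction.{u} Γ) : Prop where
  conj_eq : ∀ (K Ω : Type u) [Field K] [Field Ω] [Algebra K Ω] [IsSepClosure K Ω] (O : Subring K),
    IsLocalField K O → ∀ (ρ : Rep K Ω Γ) (γ : Γ), c K Ω O (ρ.conj γ) = c K Ω O ρ
  iso_eq : ∀ (K Ω : Type u) [Field K] [Field Ω] [Algebra K Ω] [IsSepClosure K Ω] (O : Subring K)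
    (K' Ω' : Type u) [Field K'] [Field Ω'] [Algebra K' Ω'] [IsSepClosure K' Ω'] (O' : Subring K'),
    IsLocalField K O → IsLocalField K' O' →
    ∀ (e : K ≃+* K') (E : Ω ≃+* Ω'), O.map (e : K →+* K') = O' →
      (∀ x : K, E (algebraMap K Ω x) = algebraMap K' Ω' (e x)) →
      ∀ (ρ : Rep K Ω Γ) (ρ' : Rep K' Ω' Γ),
        (∀ (g : Gal(Ω/K)) (g' : Gal(Ω'/K')), (∀ x : Ω, E (g x) = g' (E x)) → ρ.1 g = ρ'.1 g') →
        c K Ω O ρ = c K' Ω' O' ρ'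

/-- A class of local fields; only its members `(K, O)` with `IsLocalField K O` are used. -/
abbrev FieldClass := ∀ (K : Type u) [Field K], Subring K → Prop

section Mass

variable {Γ : Type*} [Group Γ] (X : Type*) [Fintype X] [MulAction Γ X]

/-- For every local field `K` in `S`, the total mass of `(K, Γ, c, σ)` converges and
is equal to `f(1/q_K)`. -/
def IsMassFormula (S : FieldClass.{u}) (c : RepFunction.{u} Γ) (σ : Multiset (ℕ × ℕ))
    (f : Polynomial ℤ) : Prop :=
  ∀ (K Ω : Type u) [Field K] [Field Ω] [Algebra K Ω] [IsSepClosure K Ω] (O : Subring K),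
    IsLocalField K O → S K O →
    HasSum (fun ρ : {ρ : Rep K Ω Γ // repType X O ρ = σ} =>
        ((residueCard O : ℝ) ^ c K Ω O ρ.1)⁻¹)
      (Polynomial.aeval ((residueCard O : ℝ)⁻¹) f)

/-- `(Γ, c)` has mass formulas for `S` by type. -/
def HasMassFormulasByType (S : FieldClass.{u}) (c : RepFunction.{u} Γ) : Prop :=
  ∀ σ : Multiset (ℕ × ℕ), ∃ f : Polynomial ℤ, IsMassFormula X S c σ f

end Mass

/-! ### Wreath products -/

/-- The wreath product `A ≀ B`, for `B` acting on `Y`: the semidirect product of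
`A^Y` with `B`, where `(b • F) j = F (b⁻¹ • j)`. -/
abbrev Wreath (A B Y : Type*) [Group A] [Group B] [MulAction B Y] :=
  SemidirectProduct (Y → A) B (mulAutArrow (G := B) (A := Y) (M := A))

/-- The natural action of `A ≀ B` on the disjoint union `Y × X` of copies of `X` indexed by `Y`. -/
instance wreathAction (A B Y X : Type*) [Group A] [Group B] [MulAction B Y] [MulAction A X] :
    MulAction (Wreath A B Y) (Y × X) where
  smul w p := (w.right • p.1, w.left (w.right • p.1) • p.2)
  one_smul p := by
    change ((1 : B) • p.1, (1 : A) • p.2) = p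
    simp
  mul_smul v w p := by
    change ((v.right * w.right) • p.1,
        (v.left ((v.right * w.right) • p.1) *
          w.left (v.right⁻¹ • (v.right * w.right) • p.1)) • p.2) =
      (v.right • w.right • p.1,
        v.left (v.right • w.right • p.1) • w.left (w.right • p.1) • p.2)
    simp [mul_smul]

/-- A separable closure of `K` is a separable closure of each of its subfields over `K`. -/
instance isSepClosure_intermediate {K Ω : Type*} [Field K] [Field Ω] [Algebra K Ω]
    [IsSepClosure K Ω] (L : IntermediateField K Ω) : IsSepClosure L Ω :=
  ⟨IsSepClosure.sep_closed K, Algebra.isSeparable_tower_top_of_isSeparable K L Ω⟩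

/-- The inclusion `Gal(Ω/L) → Gal(Ω/K)`. -/
def galRes {K Ω : Type*} [Field K] [Field Ω] [Algebra K Ω] (L : IntermediateField K Ω) :
    Gal(Ω/L) →* Gal(Ω/K) :=
  AlgEquiv.restrictScalarsHom K

theorem galRes_continuous {K Ω : Type*} [Field K] [Field Ω] [Algebra K Ω]
    [Algebra.IsAlgebraic K Ω] (L : IntermediateField K Ω) : Continuous (galRes L) := by
  refine continuous_of_continuousAt_one _ ?_
  intro s hs
  rw [map_one, krullTopology_mem_nhds_one_iff] at hs
  obtain ⟨E, hE, hs⟩ := hs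
  let b := Module.finBasis K E
  have halg : Algebra.IsIntegral L Ω := ⟨fun x => (Algebra.IsIntegral.isIntegral (R := K) x).tower_top⟩
  have hopen : IsOpen (⋂ i, (MulAction.stabilizer Gal(Ω/L) ((b i : E) : Ω) : Set Gal(Ω/L))) :=
    isOpen_iInter_of_finite fun i => stabilizer_isOpen_of_isIntegral (K := L) _
  refine Filter.mem_map.2 (Filter.mem_of_superset (hopen.mem_nhds (Set.mem_iInter.2 fun i => one_mem _)) ?_)
  intro g hg
  apply hs
  rw [SetLike.mem_coe, IntermediateField.mem_fixingSubgroup_iff]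
  intro x hx
  have key : (galRes L g).toAlgHom.toLinearMap ∘ₗ E.val.toLinearMap = E.val.toLinearMap := by
    refine b.ext fun i => ?_
    have := Set.mem_iInter.1 hg i
    exact this
  exact LinearMap.congr_fun key ⟨x, hx⟩

theorem Rep.stab_isClosed {K Ω Γ X : Type*} [Field K] [Field Ω] [Algebra K Ω] [Group Γ]
    [MulAction Γ X] (ρ : Rep K Ω Γ) (x : X) : IsClosed (ρ.stab x : Set Gal(Ω/K)) := by
  let _ : TopologicalSpace Γ := ⊥
  have : DiscreteTopology Γ := ⟨rfl⟩
  exact (isClosed_discrete (MulAction.stabilizer Γ x : Set Γ)).preimage ρ.2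

theorem galRes_mem_stab {K Ω Γ X : Type*} [Field K] [Field Ω] [Algebra K Ω] [IsSepClosure K Ω]
    [Group Γ] [MulAction Γ X] (ρ : Rep K Ω Γ) (x : X) (g : Gal(Ω/ρ.pointField x)) :
    galRes (ρ.pointField x) g ∈ ρ.stab x := by
  have h := InfiniteGalois.fixingSubgroup_fixedField (k := K) (K := Ω)
    ⟨ρ.stab x, ρ.stab_isClosed x⟩
  change (ρ.pointField x).fixingSubgroup = ρ.stab x at h
  rw [← h, IntermediateField.mem_fixingSubgroup_iff]
  intro y hy
  exact g.commutes ⟨y, hy⟩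

section WreathRep

variable {K Ω : Type u} [Field K] [Field Ω] [Algebra K Ω]
variable {A B Y : Type*} [Group A] [Group B] [MulAction B Y]

/-- The quotient `ρ̄ : Gal(Ω/K) → B` of `ρ : Gal(Ω/K) → A ≀ B`. -/
def barRep (ρ : Rep K Ω (Wreath A B Y)) : Rep K Ω B :=
  ρ.map SemidirectProduct.rightHom

/-- The representation `ρ_j : Gal(Ω/L_j) → A`, where `L_j` is the fixed field of the stabilizer of
`j`, given by the action on the `j`-th copy of the set on which `A` acts. -/
def pointRep [IsSepClosure K Ω] (ρ : Rep K Ω (Wreath A B Y)) (j : Y) :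
    Rep ((barRep ρ).pointField j) Ω A :=
  ⟨{ toFun := fun g => (ρ.1 (galRes _ g)).left j
     map_one' := by simp
     map_mul' := by
      intro g h
      have hg : (ρ.1 (galRes _ g)).right • j = j := galRes_mem_stab (barRep ρ) j g
      have hg' : (ρ.1 (galRes _ g)).right⁻¹ • j = j := by rw [inv_smul_eq_iff, hg]
      rw [map_mul, map_mul, SemidirectProduct.mul_left]
      change _ * (ρ.1 (galRes _ h)).left ((ρ.1 (galRes _ g)).right⁻¹ • j) = _
      rw [hg'] },
    by
      let _ : TopologicalSpace (Wreath A B Y) := ⊥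
      exact continuous_comp_discrete (Continuous.comp ρ.2 (galRes_continuous _))
        fun w : Wreath A B Y => w.left j⟩

variable [Fintype Y] [LinearOrder Y]

open Classical in
/-- The canonical representatives of the orbits of `ρ̄` on `Y` (the least element of each
orbit), in increasing order. -/
def orbitReps (φ : Rep K Ω B) : List Y :=
  (Finset.univ.filter fun j : Y => ∀ k ∈ MulAction.orbit φ.1.range j, j ≤ k).sort (· ≤ ·)

/-- The list of the terms `f_i^{e_i}(σ_i)`, where `i` runs through the canonical orbit representatives
of `ρ̄` in increasing order, `f_i^{e_i}` is the symbol of the orbit of `i` and `σ_i` is the type of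
`ρ_i`. -/
def wreathTerms (X : Type*) [Fintype X] [MulAction A X] [IsSepClosure K Ω] (O : Subring K)
    (ρ : Rep K Ω (Wreath A B Y)) : List ((ℕ × ℕ) × Multiset (ℕ × ℕ)) :=
  (orbitReps (barRep ρ)).map fun i =>
    (symbolAt O (barRep ρ) i, repType X (integersIn O ((barRep ρ).pointField i)) (pointRep ρ i))

/-- `ρ` has wreath type `T = (f₁^{e₁}(σ₁) ⋯ f_r^{e_r}(σ_r))`.  The type `(f₁^{e₁} ⋯ f_r^{e_r})` of
`ρ̄` is unordered, and terms of `T` whose symbols `f^e` are equal correspond in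
order to the canonical orbit representatives with that symbol. -/
def HasWreathType (X : Type*) [Fintype X] [MulAction A X] [IsSepClosure K Ω] (O : Subring K)
    (ρ : Rep K Ω (Wreath A B Y)) (T : List ((ℕ × ℕ) × Multiset (ℕ × ℕ))) : Prop :=
  ∀ s : ℕ × ℕ, (wreathTerms X O ρ).filter (fun t => t.1 = s) = T.filter (fun t => t.1 = s)

end WreathRep

/-- The function `c(ρ) = c_B(ρ̄) + ∑ᵢ fᵢ c_A(ρᵢ)`, where `i` runs through the canonical orbit
representatives of `ρ̄`. -/
def wreathCount {A B : Type*} (Y : Type*) [Group A] [Group B] [MulAction B Y] [Fintype Y]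
    [LinearOrder Y] (cA : RepFunction.{u} A) (cB : RepFunction.{u} B) :
    RepFunction.{u} (Wreath A B Y) :=
  fun K Ω _ _ _ _ O ρ =>
    cB K Ω O (barRep ρ) +
      ((orbitReps (barRep ρ)).map fun i : Y =>
        (symbolAt O (barRep ρ) i).1 *
          cA ((barRep ρ).pointField i) Ω (integersIn O ((barRep ρ).pointField i))
            (pointRep ρ i)).sum

/-- The class `S` contains, for every `K` in `S` and every representation `φ : Gal(Ω/K) → B`, the
fixed fields of the stabilizers of the points of `Y`.  This holds in particular when `S` is
closed under finite separable extensions. -/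
def ContainsPointFields (S : FieldClass.{u}) (B Y : Type*) [Group B] [MulAction B Y] : Prop :=
  ∀ (K Ω : Type u) [Field K] [Field Ω] [Algebra K Ω] [IsSepClosure K Ω] (O : Subring K),
    IsLocalField K O → S K O →
    ∀ (φ : Rep K Ω B) (j : Y), S (φ.pointField j) (integersIn O (φ.pointField j))

/-! ### Direct products -/

/-- The natural action of `A × B` on the disjoint union `X ⊕ Y`. -/
instance prodAction (A B X Y : Type*) [Group A] [Group B] [MulAction A X] [MulAction B Y] :
    MulAction (A × B) (X ⊕ Y) where
  smul g := Sum.map (g.1 • ·) (g.2 • ·)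
  one_smul p := by
    change Sum.map ((1 : A) • ·) ((1 : B) • ·) p = p
    cases p <;> simp
  mul_smul g h p := by
    change Sum.map ((g.1 * h.1) • ·) ((g.2 * h.2) • ·) p =
      Sum.map (g.1 • ·) (g.2 • ·) (Sum.map (h.1 • ·) (h.2 • ·) p)
    cases p <;> simp [mul_smul]

/-- The function `c(ρ × ρ') = c_A(ρ) + c_B(ρ')`. -/
def prodCount {A B : Type*} [Group A] [Group B] (cA : RepFunction.{u} A) (cB : RepFunction.{u} B) :
    RepFunction.{u} (A × B) :=
  fun K Ω _ _ _ _ O ρ =>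
    cA K Ω O (ρ.map (MonoidHom.fst A B)) + cB K Ω O (ρ.map (MonoidHom.snd A B))

/-- `ρ × ρ'` has product type `(σ, σ')`: `ρ` has type `σ` and `ρ'` has type `σ'`. -/
def HasProductType {K Ω : Type u} [Field K] [Field Ω] [Algebra K Ω] {A B : Type*} (X Y : Type*)
    [Group A] [Group B] [Fintype X] [MulAction A X] [Fintype Y] [MulAction B Y] (O : Subring K)
    (ρ : Rep K Ω (A × B)) (σ τ : Multiset (ℕ × ℕ)) : Prop :=
  repType X O (ρ.map (MonoidHom.fst A B)) = σ ∧ repType Y O (ρ.map (MonoidHom.snd A B)) = τ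

end MassFormula

end

/-!
Fix `φ : Gal(Ω/K) → B`, let `L_i` be the fixed field of the stabilizer of `i : Y`, and choose for
every `j : Y` an element of `Gal(Ω/K)` that moves the least element of its orbit to `j`. In the
manner of Shapiro's lemma, a lift `ρ` of `φ` to `A ≀ B` is then the same as a family of
representations `ρ_i : Gal(Ω/L_i) → A`, one for each of the `r` least elements `i` of the orbits,
together with one arbitrary element of `A` for each of the `|Y| - r` remaining points.

The symbol `f^e` of the orbit of `i` satisfies `q_{L_i} = q_K ^ f`, so that `q_K ^ (-c(ρ))` is the
product of `q_K ^ (-c_B(φ))` and the `q_{L_i} ^ (-c_A(ρ_i))`. Hence the sum over the lifts of `φ` of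
a given wreath type is `|A| ^ (|Y| - r)` times a product of mass formulas of `A` over the fields
`L_i`; this depends on `φ` only through its term `q_K ^ (-c_B(φ))`, and the sum over `φ` is a mass
formula of `B`. The symbol of the orbit of `(i, x)` under `ρ` is the product of the symbols of `i`
under `φ` and of `x` under `ρ_i`, so the wreath type determines the type, and adding up the finitely
many wreath types that give the same type yields the mass formulas of `A ≀ B` by type.

That `c` is invariant under conjugation and under isomorphisms of local fields is less immediate
than it looks, as the least elements of the orbits are not preserved. It holds because an element of
`Gal(Ω/K)` that moves `i` to `j` is an isomorphism of `L_i` with `L_j` which carries `ρ_i` to a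
conjugate of `ρ_j`, so that every representative of an orbit contributes the same term.
-/

noncomputable section

namespace MassFormula

section LocalField

variable {K : Type u}

open scoped ValuativeRel in
theorem IsLocalField.exists_norm [inst : Field K] {O : Subring K} (h : IsLocalField K O) :
    ∃ n : NontriviallyNormedField K, n.toNormedField.toField = inst ∧ IsUltrametricDist K ∧
      ProperSpace K ∧ ∀ x : K, x ∈ O ↔ ‖x‖ ≤ 1 := by
  obtain ⟨vr, top, h, rfl⟩ := h
  let := IsTopologicalAddGroup.rightUniformSpace K
  have := isUniformAddGroup_of_addCommGroup (G := K)
  let embedding := (ValuativeRel.IsRankLeOne.nonempty (R := K)).some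
  let rankOne : (Valued.v (R := K) (Γ₀ := ValuativeRel.ValueGroupWithZero K)).RankOne :=
    { hom' := embedding.emb.comp MonoidWithZeroHom.ValueGroup₀.embedding
      strictMono' := embedding.strictMono.comp
        MonoidWithZeroHom.ValueGroup₀.embedding_strictMono }
  let norm := Valued.toNontriviallyNormedField (L := K) (Γ₀ := ValuativeRel.ValueGroupWithZero K)
  exact ⟨norm, rfl, inferInstance, .of_nontriviallyNormedField_of_weaklyLocallyCompactSpace K,
    fun x => (Valued.toNormedField.norm_le_one_iff (hv := rankOne)).symm⟩

theorem isLocalField_of_norm [NontriviallyNormedField K] [IsUltrametricDist K] [ProperSpace K]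
    {O : Subring K} (hO : ∀ x : K, x ∈ O ↔ ‖x‖ ≤ 1) : IsLocalField K O := by
  let v : Valuation K NNReal := NormedField.valuation
  let _ := ValuativeRel.ofValuation v
  have : v.Compatible := .ofValuation v
  let _ : Valued K NNReal := NormedField.toValued
  have : IsValuativeTopology K :=
    .of_mem_nhds_zero_iff_vle v fun {s} => Valued.mem_nhds_zero
  refine ⟨inferInstance, inferInstance, { condition := ?_ }, ?_⟩
  · obtain ⟨x, hx⟩ := NormedField.exists_one_lt_norm K
    have hx_gt : ValuativeRel.valuation K 1 < ValuativeRel.valuation K x := by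
      rw [← (ValuativeRel.valuation K).vlt_iff_lt, v.vlt_iff_lt, map_one]
      exact NNReal.coe_lt_coe.1 hx
    rw [map_one] at hx_gt
    exact ⟨_, (zero_lt_one.trans hx_gt).ne', hx_gt.ne'⟩
  · ext x
    rw [hO, Valuation.mem_integer_iff, ← (ValuativeRel.valuation K).vle_one_iff, v.vle_one_iff]
    rfl

theorem isUltrametricDist_spectralNorm [NontriviallyNormedField K] [IsUltrametricDist K]
    [CompleteSpace K] (L : Type*) [Field L] [Algebra K L] [Algebra.IsAlgebraic K L] :
    letI := spectralNorm.normedField K L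
    IsUltrametricDist L :=
  letI := spectralNorm.normedField K L
  IsUltrametricDist.isUltrametricDist_of_isNonarchimedean_norm
    (isNonarchimedean_spectralNorm (K := K) (L := L))

theorem mem_integersIn_iff_spectralNorm_le_one [NontriviallyNormedField K] [IsUltrametricDist K]
    [CompleteSpace K] {O : Subring K} (hO : ∀ x : K, x ∈ O ↔ ‖x‖ ≤ 1) {L : Type u} [Field L]
    [Algebra K L] [Algebra.IsAlgebraic K L] (x : L) :
    x ∈ integersIn O L ↔ spectralNorm K L x ≤ 1 := by
  constructor
  · rintro ⟨p, hp, hpx⟩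
    let _ := spectralNorm.normedField K L
    have := isUltrametricDist_spectralNorm (K := K) L
    let f : O →+* (NormedField.valuation (K := L)).integer :=
      ((algebraMap K L).comp O.subtype).codRestrict _ fun y =>
        ((spectralNorm_extends (L := L) (y : K)).trans_le ((hO y).1 y.2) :)
    exact (Valuation.integer.integers (NormedField.valuation (K := L))).mem_of_integral
      ⟨p.map f, hp.map f, by rw [Polynomial.eval₂_map]; exact hpx⟩
  · intro h
    have hm := minpoly.monic (Algebra.IsIntegral.isIntegral (R := K) x)
    rw [spectralNorm, spectralValue_le_one_iff hm] at h
    have hl : minpoly K x ∈ Polynomial.lifts O.subtype :=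
      (Polynomial.lifts_iff_coeff_lifts _).2 fun n => by simpa using (hO _).2 (h n)
    obtain ⟨q, hq, -, hqm⟩ := Polynomial.lifts_and_natDegree_eq_and_monic hl hm
    refine ⟨q, hqm, ?_⟩
    have hx := minpoly.aeval K x
    rwa [← hq, Polynomial.aeval_def, Polynomial.eval₂_map] at hx

theorem isLocalField_integersIn [Field K] {O : Subring K} (h : IsLocalField K O) (L : Type u)
    [Field L] [Algebra K L] [FiniteDimensional K L] : IsLocalField L (integersIn O L) := by
  obtain ⟨n, rfl, _, _, hO⟩ := h.exists_norm
  let _ := spectralNorm.nontriviallyNormedField K L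
  let _ := spectralNorm.normedAlgebra K L
  have := isUltrametricDist_spectralNorm (K := K) L
  have : ProperSpace L := FiniteDimensional.proper K L
  exact isLocalField_of_norm (mem_integersIn_iff_spectralNorm_le_one hO)

theorem IsLocalField.isLocalRing_integersIn [Field K] {O : Subring K} (h : IsLocalField K O)
    (L : Type u) [Field L] [Algebra K L] [Algebra.IsAlgebraic K L] :
    IsLocalRing (integersIn O L) := by
  obtain ⟨n, rfl, _, _, hO⟩ := h.exists_norm
  let _ := spectralNorm.normedField K L
  have mem_or_inv_mem (x : L) : x ∈ integersIn O L ∨ x⁻¹ ∈ integersIn O L := by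
    rw [mem_integersIn_iff_spectralNorm_le_one hO, mem_integersIn_iff_spectralNorm_le_one hO]
    change ‖x‖ ≤ 1 ∨ ‖x⁻¹‖ ≤ 1
    rw [norm_inv]
    exact (le_total ‖x‖ 1).imp_right inv_le_one_of_one_le₀
  exact inferInstanceAs (IsLocalRing (ValuationSubring.ofSubring (integersIn O L) mem_or_inv_mem))

theorem IsLocalField.integersIn_self [Field K] {O : Subring K} (h : IsLocalField K O) :
    integersIn O K = O := by
  obtain ⟨n, rfl, _, _, hO⟩ := h.exists_norm
  ext x
  rw [mem_integersIn_iff_spectralNorm_le_one hO, hO, ← spectralNorm_extends (K := K) (L := K) x]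
  rfl

open scoped ValuativeRel in
theorem IsLocalField.residueCard_pos [Field K] {O : Subring K} (h : IsLocalField K O) :
    0 < residueCard O := by
  obtain ⟨vr, top, h, rfl⟩ := h
  have : Finite 𝓀[K] := inferInstance
  rw [residueCard, IsLocalRing.jacobson_eq_maximalIdeal _ bot_ne_top]
  exact Nat.card_pos (α := 𝓀[K])

theorem integersIn_integersIn [Field K] {Ω : Type u} [Field Ω] [Algebra K Ω] (O : Subring K)
    (L : IntermediateField K Ω) : integersIn (integersIn O L) Ω = integersIn O Ω := by
  ext x
  have : IsScalarTower O (integralClosure O L) Ω := by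
    exact IsScalarTower.of_algebraMap_eq fun _ => rfl
  exact ⟨isIntegral_trans (R := O) (A := integralClosure O L) x,
    fun h : IsIntegral O x => h.tower_top (A := integralClosure O L)⟩

end LocalField

section FixedResidueField

open IsLocalRing IntermediateField

variable (G R : Type*) [Group G] [CommRing R] [IsLocalRing R] [MulSemiringAction G R]

/-- The residue field of the subring of elements of the local ring `R` that are fixed by `G`,
as a subfield of the residue field of `R`. -/
def fixedResidueField : Subfield (ResidueField R) where
  toSubring := (FixedPoints.subring R G).map (residue R)
  inv_mem' := by
    rintro _ ⟨r, hr, rfl⟩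
    by_cases hu : IsUnit r
    · obtain ⟨u, rfl⟩ := hu
      refine ⟨(u⁻¹ : Rˣ), fun g => Units.eq_inv_of_mul_eq_one_right ?_, map_units_inv _ _⟩
      nth_rw 1 [← hr g]
      rw [← smul_mul', u.inv_mul, smul_one]
    · rw [(residue_eq_zero_iff r).2 hu, inv_zero]
      exact ⟨0, fun g => smul_zero g, map_zero _⟩

variable {G R}

theorem smul_eq_of_mem_fixedResidueField {x : ResidueField R} (hx : x ∈ fixedResidueField G R)
    (g : G) : g • x = x := by
  obtain ⟨r, hr, rfl⟩ := hx
  rw [← ResidueField.residue_smul, hr]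

theorem fixedResidueField_le_subgroup (H : Subgroup G) :
    fixedResidueField G R ≤ fixedResidueField H R := by
  rintro _ ⟨r, hr, rfl⟩
  exact ⟨r, fun h => hr h, rfl⟩

instance : SMulCommClass G (fixedResidueField G R) (ResidueField R) where
  smul_comm g a x := by
    rw [Subfield.smul_def, Subfield.smul_def, smul_eq_mul, smul_eq_mul, smul_mul',
      smul_eq_of_mem_fixedResidueField a.2]

instance : Algebra.IsInvariant (FixedPoints.subring R G) R G where
  isInvariant r hr := ⟨⟨r, hr⟩, rfl⟩

section Profinite

variable [TopologicalSpace G] [IsTopologicalGroup G] [CompactSpace G] [TotallyDisconnectedSpace G]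
  [TopologicalSpace R] [DiscreteTopology R] [ContinuousSMul G R]

theorem exists_smul_eq_of_fixes (τ : ResidueField R ≃+* ResidueField R)
    (hτ : ∀ x ∈ fixedResidueField G R, τ x = x) : ∃ g : G, ∀ x : ResidueField R, g • x = τ x := by
  let R₀ := FixedPoints.subring R G
  let P := (maximalIdeal R).under R₀
  have : (maximalIdeal R).LiesOver P := ⟨rfl⟩
  let τ' : (R ⧸ maximalIdeal R) ≃ₐ[R₀ ⧸ P] (R ⧸ maximalIdeal R) := .ofRingEquiv (f := τ) <| by
    intro x
    obtain ⟨a, rfl⟩ := Ideal.Quotient.mk_surjective x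
    exact hτ _ ⟨a, a.2, rfl⟩
  obtain ⟨g, hg⟩ := Ideal.Quotient.stabilizerHom_surjective_of_profinite (G := G) P _ τ'
  refine ⟨g, fun x => ?_⟩
  obtain ⟨r, rfl⟩ := residue_surjective x
  exact DFunLike.congr_fun hg (Ideal.Quotient.mk _ r)

variable (G R) in
theorem isAlgebraic_fixedResidueField :
    Algebra.IsAlgebraic (fixedResidueField G R) (ResidueField R) := by
  have hR : Algebra.IsIntegral (FixedPoints.subring R G) R :=
    Algebra.IsInvariant.isIntegral_of_profinite (G := G)
  refine Algebra.isAlgebraic_iff_isIntegral.2 ⟨fun x => ?_⟩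
  obtain ⟨r, rfl⟩ := residue_surjective x
  let f : FixedPoints.subring R G →+* fixedResidueField G R :=
    ((residue R).comp (FixedPoints.subring R G).subtype).codRestrict _ fun a => ⟨a, a.2, rfl⟩
  exact (hR.isIntegral r).map_of_comp_eq f (residue R) rfl

end Profinite

theorem isGalois_of_finite_of_isAlgebraic (k E : Type*) [Field k] [Finite k] [Field E] [Algebra k E]
    [Algebra.IsAlgebraic k E] : IsGalois k E where
  to_normal := by
    refine ⟨fun x => ?_⟩
    have := IntermediateField.adjoin.finiteDimensional (Algebra.IsIntegral.isIntegral (R := k) x)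
    have : Finite k⟮x⟯ := Module.finite_of_finite k
    have h := (inferInstance : Normal k k⟮x⟯).splits (IntermediateField.AdjoinSimple.gen k x)
    rw [IntermediateField.minpoly_gen] at h
    simpa only [Polynomial.map_map, ← IsScalarTower.algebraMap_eq] using
      h.map (algebraMap k⟮x⟯ E)

/-- The subgroup of `G` that acts trivially on the residue field of the local ring `R`. -/
def residueInertia (G R : Type*) [Group G] [CommRing R] [IsLocalRing R] [MulSemiringAction G R] :
    Subgroup G :=
  (MulSemiringAction.toRingAut G (ResidueField R)).ker

theorem mem_residueInertia {g : G} :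
    g ∈ residueInertia G R ↔ ∀ x : ResidueField R, g • x = x :=
  RingEquiv.ext_iff

section Profinite

variable [TopologicalSpace G] [IsTopologicalGroup G] [CompactSpace G] [TotallyDisconnectedSpace G]
  [TopologicalSpace R] [DiscreteTopology R] [ContinuousSMul G R]

theorem comap_toAlgAut_fixingSubgroup {H : Subgroup G} (hH : IsClosed (H : Set G)) :
    ((Subfield.extendScalars (fixedResidueField_le_subgroup (R := R) H)).fixingSubgroup).comap
      (MulSemiringAction.toAlgAut G (fixedResidueField G R) (ResidueField R)) =
        residueInertia G R ⊔ H := by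
  have := isCompact_iff_compactSpace.1 hH.isCompact
  apply le_antisymm
  · intro g hg
    obtain ⟨h, hh⟩ := exists_smul_eq_of_fixes (G := H) (MulSemiringAction.toRingEquiv G _ g)
      ((mem_fixingSubgroup_iff _ _).1 hg)
    have hI : g * (h : G)⁻¹ ∈ residueInertia G R := mem_residueInertia.2 fun x =>
      (mul_smul _ _ x).trans ((hh _).symm.trans (smul_inv_smul h x))
    simpa using mul_mem (Subgroup.mem_sup_left hI)
      (Subgroup.mem_sup_right (S := residueInertia G R) h.2)
  · refine sup_le (fun g hg => ?_) fun g hg => ?_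
    · exact (mem_fixingSubgroup_iff _ _).2 fun x _ => mem_residueInertia.1 hg x
    · exact (mem_fixingSubgroup_iff _ _).2 fun x hx =>
        smul_eq_of_mem_fixedResidueField (G := H) hx ⟨g, hg⟩

theorem card_fixedResidueField_subgroup [Finite (fixedResidueField G R)] {H : Subgroup G}
    (hH : IsOpen (H : Set G)) :
    Nat.card (fixedResidueField H R) =
      Nat.card (fixedResidueField G R) ^ (residueInertia G R ⊔ H).index := by
  have := isAlgebraic_fixedResidueField G R
  have := isGalois_of_finite_of_isAlgebraic (fixedResidueField G R) (ResidueField R)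
  let E := Subfield.extendScalars (fixedResidueField_le_subgroup (R := R) H)
  have index_eq : (residueInertia G R ⊔ H).index = Module.finrank (fixedResidueField G R) E := by
    rw [finrank_eq_fixingSubgroup_index, ← comap_toAlgAut_fixingSubgroup (H.isClosed_of_isOpen hH)]
    refine Subgroup.index_comap_of_surjective _ fun τ => ?_
    obtain ⟨g, hg⟩ := exists_smul_eq_of_fixes (G := G) τ.toRingEquiv fun x hx => τ.commutes ⟨x, hx⟩
    exact ⟨g, AlgEquiv.ext hg⟩
  have : FiniteDimensional (fixedResidueField G R) E := by
    have := H.quotient_finite_of_isOpen hH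
    have := H.finiteIndex_of_finite_quotient
    have := Subgroup.finiteIndex_of_le (le_sup_right (a := residueInertia G R) (b := H))
    exact .of_finrank_pos (index_eq ▸ Nat.pos_of_ne_zero Subgroup.FiniteIndex.index_ne_zero)
  rw [index_eq]
  exact Module.natCard_eq_pow_finrank (K := fixedResidueField G R) (V := E)

end Profinite

theorem natCard_fixedResidueField_of_range_eq {A : Type*} [CommRing A] [IsLocalRing A] {f : A →+* R}
    (hf : f.range = FixedPoints.subring R G) :
    Nat.card (fixedResidueField G R) = Nat.card (A ⧸ Ideal.jacobson (⊥ : Ideal A)) := by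
  have mem_fixed (a : A) : f a ∈ FixedPoints.subring R G := hf ▸ ⟨a, rfl⟩
  let π : A →+* fixedResidueField G R :=
    ((residue R).comp f).codRestrict _ fun a => ⟨f a, mem_fixed a, rfl⟩
  have hπ : Function.Surjective π := by
    rintro ⟨_, r, hr, rfl⟩
    obtain ⟨a, rfl⟩ : r ∈ f.range := hf ▸ hr
    exact ⟨a, rfl⟩
  have := RingHom.ker_isMaximal_of_surjective π hπ
  rw [jacobson_eq_maximalIdeal _ bot_ne_top, ← eq_maximalIdeal this]
  exact (Nat.card_congr (RingHom.quotientKerEquivOfSurjective hπ).toEquiv).symm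

end FixedResidueField

section GaloisResidue

open IsLocalRing

variable {K Ω : Type u} [Field K] [Field Ω] [Algebra K Ω]

instance (O : Subring K) : MulSemiringAction Gal(Ω/K) (integersIn O Ω) where
  smul g r := ⟨g r, map_mem_integersIn O g r.2⟩
  one_smul _ := rfl
  mul_smul _ _ _ := rfl
  smul_zero g := Subtype.ext (map_zero g)
  smul_add g _ _ := Subtype.ext (map_add g _ _)
  smul_one g := Subtype.ext (map_one g)
  smul_mul g _ _ := Subtype.ext (map_mul g _ _)

theorem inertia_eq_residueInertia (O : Subring K) [IsLocalRing (integersIn O Ω)] :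
    inertia O Ω = residueInertia Gal(Ω/K) (integersIn O Ω) := by
  ext g
  rw [mem_residueInertia, residue_surjective.forall]
  change (∀ x ∈ integersIn O Ω, ∃ m ∈ Ideal.jacobson (⊥ : Ideal (integersIn O Ω)),
    (m : Ω) = g x - x) ↔ _
  rw [jacobson_eq_maximalIdeal _ bot_ne_top]
  constructor
  · intro h r
    obtain ⟨m, hm, hmr⟩ := h r r.2
    obtain rfl : m = g • r - r := Subtype.ext hmr
    exact Ideal.Quotient.eq.2 hm
  · intro h x hx
    exact ⟨g • ⟨x, hx⟩ - ⟨x, hx⟩, Ideal.Quotient.eq.1 (h ⟨x, hx⟩), rfl⟩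

theorem IsLocalField.natCard_fixedResidueField_integersIn {O : Subring K} (h : IsLocalField K O)
    [IsLocalRing (integersIn O Ω)] (L : Type u) [Field L] [Algebra K L] [Algebra.IsAlgebraic K L]
    [Algebra L Ω] [IsScalarTower K L Ω] {G : Type*} [Group G]
    [MulSemiringAction G (integersIn O Ω)]
    (hG : ∀ x : integersIn O Ω, (∀ g : G, g • x = x) ↔ (x : Ω) ∈ (algebraMap L Ω).range) :
    Nat.card (fixedResidueField G (integersIn O Ω)) = residueCard (integersIn O L) := by
  have := h.isLocalRing_integersIn L
  have : IsScalarTower O L Ω := .of_algebraMap_eq fun x => IsScalarTower.algebraMap_apply K L Ω x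
  have isIntegral_iff (y : L) : algebraMap L Ω y ∈ integersIn O Ω ↔ y ∈ integersIn O L :=
    isIntegral_algebraMap_iff (algebraMap L Ω).injective
  let f : integersIn O L →+* integersIn O Ω :=
    ((algebraMap L Ω).comp (integersIn O L).subtype).codRestrict _ fun y =>
      (isIntegral_iff y).2 y.2
  refine natCard_fixedResidueField_of_range_eq (f := f) (SetLike.ext fun x => ?_)
  refine Iff.trans ⟨?_, ?_⟩ (hG x).symm
  · rintro ⟨y, rfl⟩
    exact ⟨y, rfl⟩
  · rintro ⟨y, hy⟩
    exact ⟨⟨y, (isIntegral_iff y).1 (hy ▸ x.2)⟩, Subtype.ext hy⟩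

theorem IsLocalField.residueCard_integersIn [IsSepClosure K Ω] {O : Subring K}
    (h : IsLocalField K O) (L : IntermediateField K Ω) [FiniteDimensional K L] :
    residueCard (integersIn O L) = residueCard O ^ (inertia O Ω ⊔ L.fixingSubgroup).index := by
  have := h.isLocalRing_integersIn Ω
  let _ : TopologicalSpace (integersIn O Ω) := ⊥
  have : DiscreteTopology (integersIn O Ω) := ⟨rfl⟩
  have : ContinuousSMul Gal(Ω/K) (integersIn O Ω) := by
    refine continuousSMul_iff_stabilizer_isOpen.2 fun r => ?_
    convert stabilizer_isOpen_of_isIntegral (K := K) (r : Ω) using 1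
    ext g
    exact Subtype.ext_iff
  have card_K : Nat.card (fixedResidueField Gal(Ω/K) (integersIn O Ω)) = residueCard O := by
    rw [h.natCard_fixedResidueField_integersIn K fun x => ?_, h.integersIn_self]
    exact (forall_congr' fun g => Subtype.ext_iff).trans
      (InfiniteGalois.mem_range_algebraMap_iff_fixed (k := K) (x : Ω)).symm
  have card_L : Nat.card (fixedResidueField L.fixingSubgroup (integersIn O Ω)) =
      residueCard (integersIn O L) := by
    refine h.natCard_fixedResidueField_integersIn L fun x => ?_
    have mem_L : (x : Ω) ∈ IntermediateField.fixedField L.fixingSubgroup ↔ (x : Ω) ∈ L := by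
      rw [InfiniteGalois.fixedField_fixingSubgroup]
    exact (forall_congr' fun g => Subtype.ext_iff).trans
      (mem_L.trans (SetLike.ext_iff.1 L.toSubalgebra.rangeS_algebraMap (x : Ω)).symm)
  have : Finite (fixedResidueField Gal(Ω/K) (integersIn O Ω)) :=
    Nat.finite_of_card_ne_zero (card_K ▸ h.residueCard_pos.ne')
  rw [← card_L, card_fixedResidueField_subgroup L.fixingSubgroup_isOpen, card_K,
    inertia_eq_residueInertia]

end GaloisResidue

/-- An isomorphism `base : K ≃ K'` that identifies the subrings `O` and `O'`, together with an
extension `top : Ω ≃ Ω'` of it. -/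
structure ExtensionEquiv {K K' : Type u} [Field K] [Field K'] (O : Subring K) (O' : Subring K')
    (Ω Ω' : Type u) [Field Ω] [Field Ω'] [Algebra K Ω] [Algebra K' Ω'] where
  base : K ≃+* K'
  top : Ω ≃+* Ω'
  base_mem_iff : ∀ x, base x ∈ O' ↔ x ∈ O
  top_algebraMap : ∀ x, top (algebraMap K Ω x) = algebraMap K' Ω' (base x)

namespace ExtensionEquiv

variable {K Ω K' Ω' : Type u} [Field K] [Field Ω] [Algebra K Ω] [Field K'] [Field Ω']
  [Algebra K' Ω'] {O : Subring K} {O' : Subring K'}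

/-- The inverse isomorphism of extensions. -/
def symm (F : ExtensionEquiv O O' Ω Ω') : ExtensionEquiv O' O Ω' Ω where
  base := F.base.symm
  top := F.top.symm
  base_mem_iff x := by rw [← F.base_mem_iff, F.base.apply_symm_apply]
  top_algebraMap x := by
    rw [F.top.symm_apply_eq, F.top_algebraMap, F.base.apply_symm_apply]

variable (O) in
/-- A Galois automorphism, as an automorphism of the extension `Ω` of `K`. -/
def ofGal (g : Gal(Ω/K)) : ExtensionEquiv O O Ω Ω where
  base := RingEquiv.refl K
  top := g.toRingEquiv
  base_mem_iff _ := Iff.rfl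
  top_algebraMap := g.commutes

/-- The isomorphism `g ↦ top ∘ g ∘ top⁻¹` of Galois groups. -/
def galEquiv (F : ExtensionEquiv O O' Ω Ω') : Gal(Ω/K) ≃* Gal(Ω'/K') where
  toFun g := .ofRingEquiv (f := F.top.symm.trans (g.toRingEquiv.trans F.top)) fun x => by
    obtain ⟨y, rfl⟩ := F.base.surjective x
    simp [← F.top_algebraMap]
  invFun g := .ofRingEquiv (f := F.top.trans (g.toRingEquiv.trans F.top.symm)) fun x => by
    simp [F.top_algebraMap, RingEquiv.symm_apply_eq]
  left_inv g := by ext; simp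
  right_inv g := by ext; simp
  map_mul' g h := by ext; simp

theorem galEquiv_apply_top (F : ExtensionEquiv O O' Ω Ω') (g : Gal(Ω/K)) (x : Ω) :
    F.galEquiv g (F.top x) = F.top (g x) := by
  simp [galEquiv]

theorem eq_galEquiv_iff (F : ExtensionEquiv O O' Ω Ω') {g : Gal(Ω/K)} {g' : Gal(Ω'/K')} :
    g' = F.galEquiv g ↔ ∀ x, F.top (g x) = g' (F.top x) := by
  rw [AlgEquiv.ext_iff, F.top.surjective.forall]
  simp only [galEquiv_apply_top, eq_comm]

theorem galEquiv_ofGal (g h : Gal(Ω/K)) : (ofGal O g).galEquiv h = g * h * g⁻¹ :=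
  ((ofGal O g).eq_galEquiv_iff.2 fun x =>
    congrArg (fun y => g (h y)) (g.symm_apply_apply x).symm).symm

theorem top_mem_integersIn (F : ExtensionEquiv O O' Ω Ω') {x : Ω} (hx : x ∈ integersIn O Ω) :
    F.top x ∈ integersIn O' Ω' := by
  let f : O →+* O' := ((F.base : K →+* K').comp O.subtype).codRestrict O'
    fun y => (F.base_mem_iff y).2 y.2
  exact IsIntegral.map_of_comp_eq f (F.top : Ω →+* Ω')
    (RingHom.ext fun y => (F.top_algebraMap y).symm) hx

theorem top_mem_integersIn_iff (F : ExtensionEquiv O O' Ω Ω') {x : Ω} :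
    F.top x ∈ integersIn O' Ω' ↔ x ∈ integersIn O Ω :=
  ⟨fun h => F.top.symm_apply_apply x ▸ F.symm.top_mem_integersIn h, F.top_mem_integersIn⟩

theorem galEquiv_mem_inertia (F : ExtensionEquiv O O' Ω Ω') {g : Gal(Ω/K)}
    (hg : g ∈ inertia O Ω) : F.galEquiv g ∈ inertia O' Ω' := by
  let E : integersIn O Ω ≃+* integersIn O' Ω' :=
    F.top.restrict _ _ fun _ => F.top_mem_integersIn_iff.symm
  have map_jacobson : Ideal.map (E : integersIn O Ω →+* integersIn O' Ω')
      (Ideal.jacobson (⊥ : Ideal (integersIn O Ω))) = Ideal.jacobson ⊥ := by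
    refine (Ideal.map_jacobson_of_bijective (f := (E : integersIn O Ω →+* integersIn O' Ω'))
      E.bijective).trans ?_
    rw [Ideal.map_bot]
  intro y hy
  obtain ⟨x, rfl⟩ := F.top.surjective y
  obtain ⟨m, hm, hmx⟩ := hg x (F.top_mem_integersIn_iff.1 hy)
  refine ⟨E m, map_jacobson ▸ Ideal.mem_map_of_mem _ hm, ?_⟩
  rw [galEquiv_apply_top, ← map_sub, ← hmx]
  rfl

theorem map_inertia (F : ExtensionEquiv O O' Ω Ω') :
    (inertia O Ω).map (F.galEquiv : Gal(Ω/K) →* Gal(Ω'/K')) = inertia O' Ω' := by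
  refine le_antisymm (Subgroup.map_le_iff_le_comap.2 fun _ => F.galEquiv_mem_inertia) fun g hg => ?_
  exact ⟨F.symm.galEquiv g, F.symm.galEquiv_mem_inertia hg, F.galEquiv.apply_symm_apply g⟩

end ExtensionEquiv

instance inertia_normal {K Ω : Type u} [Field K] [Field Ω] [Algebra K Ω] (O : Subring K) :
    (inertia O Ω).Normal where
  conj_mem i hi g := by
    rw [← ExtensionEquiv.galEquiv_ofGal (O := O)]
    exact (ExtensionEquiv.ofGal O g).galEquiv_mem_inertia hi

section Index

variable {G : Type*} [Group G]

theorem ncard_range_eq_index {Z : Type*} (H : Subgroup G) (f : G → Z)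
    (h : ∀ a b, f a = f b ↔ a⁻¹ * b ∈ H) : (Set.range f).ncard = H.index := by
  let F : G ⧸ H → Z := Quotient.lift f fun a b hab => (h a b).2 (QuotientGroup.leftRel_apply.1 hab)
  have hF : Function.Injective F := by
    rintro ⟨a⟩ ⟨b⟩ hab
    exact QuotientGroup.eq.2 ((h a b).1 hab)
  rw [← Set.range_quot_lift, Subgroup.index, Nat.card_congr (Equiv.ofInjective F hF),
    Nat.card_coe_set_eq]
  rfl

theorem relIndex_sup_of_normal (I H : Subgroup G) [I.Normal] :
    H.relIndex (I ⊔ H) = H.relIndex I := by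
  let f := Subgroup.quotientSubgroupOfEmbeddingOfLE H (le_sup_left : I ≤ I ⊔ H)
  have hf : Function.Surjective f := by
    rintro ⟨⟨g, hg⟩⟩
    obtain ⟨i, hi, h, hh, rfl⟩ := Subgroup.mem_sup_of_normal_left.1 hg
    exact ⟨QuotientGroup.mk ⟨i, hi⟩, QuotientGroup.eq.2 (by simpa [Subgroup.mem_subgroupOf])⟩
  exact (Nat.card_congr (.ofBijective f ⟨f.injective, hf⟩)).symm

theorem index_sup_mul_relIndex (I H : Subgroup G) [I.Normal] :
    (I ⊔ H).index * H.relIndex I = H.index := by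
  rw [← relIndex_sup_of_normal, mul_comm, Subgroup.relIndex_mul_index le_sup_right]

end Index

theorem mem_orbit_map {G Γ X : Type*} [Group G] [Group Γ] [MulAction Γ X] {r : G →* Γ}
    {I : Subgroup G} {x y : X} : y ∈ MulAction.orbit (I.map r) x ↔ ∃ g ∈ I, r g • x = y := by
  simp [MulAction.mem_orbit_iff, Subgroup.smul_def]

section Symbols

variable {K Ω : Type u} [Field K] [Field Ω] [Algebra K Ω] {Γ X : Type*} [Group Γ] [MulAction Γ X]

theorem Rep.mem_stab {ρ : Rep K Ω Γ} {x : X} {g : Gal(Ω/K)} : g ∈ ρ.stab x ↔ ρ.1 g • x = x :=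
  Iff.rfl

theorem Rep.mem_orbit_range {ρ : Rep K Ω Γ} {x y : X} :
    y ∈ MulAction.orbit ρ.1.range x ↔ ∃ g, ρ.1 g • x = y := by
  simp [MulAction.mem_orbit_iff, Subgroup.smul_def]

theorem symbolAt_snd (O : Subring K) (ρ : Rep K Ω Γ) (x : X) :
    (symbolAt O ρ x).2 = (ρ.stab x).relIndex (inertia O Ω) := by
  have orbit_eq : MulAction.orbit ((inertia O Ω).map ρ.1) x =
      Set.range fun g : inertia O Ω => ρ.1 g • x := by
    ext y
    simp [mem_orbit_map]
  rw [symbolAt, orbit_eq]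
  refine ncard_range_eq_index _ _ fun a b => ?_
  rw [Subgroup.mem_subgroupOf, Rep.mem_stab, eq_comm]
  simp [mul_smul, inv_smul_eq_iff]

theorem symbolAt_fst (O : Subring K) (ρ : Rep K Ω Γ) (x : X) :
    (symbolAt O ρ x).1 = (inertia O Ω ⊔ ρ.stab x).index := by
  have image_eq : (fun y : X => MulAction.orbit ((inertia O Ω).map ρ.1) y) ''
      (MulAction.orbit ρ.1.range x) =
      Set.range fun g : Gal(Ω/K) => MulAction.orbit ((inertia O Ω).map ρ.1) (ρ.1 g • x) := by
    ext y
    simp [Rep.mem_orbit_range]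
  rw [symbolAt, image_eq]
  refine ncard_range_eq_index _ _ fun a b => ?_
  rw [MulAction.orbit_eq_iff, mem_orbit_map, sup_comm, Subgroup.mem_sup_of_normal_right]
  constructor
  · rintro ⟨i, hi, h⟩
    refine ⟨a⁻¹ * i * b, ?_, b⁻¹ * i⁻¹ * b, ?_, by group⟩
    · rw [Rep.mem_stab, map_mul, map_mul, map_inv, mul_smul, mul_smul, h, inv_smul_smul]
    · simpa using (inertia_normal O).conj_mem _ (inv_mem hi) b⁻¹
  · rintro ⟨s, hs, i, hi, h⟩
    obtain rfl : b = a * s * i := by rw [mul_assoc, h, mul_inv_cancel_left]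
    refine ⟨a * s * i⁻¹ * (a * s)⁻¹, (inertia_normal O).conj_mem _ (inv_mem hi) _, ?_⟩
    rw [Rep.mem_stab] at hs
    simp [mul_smul, hs]

theorem symbolAt_mul (O : Subring K) (ρ : Rep K Ω Γ) (x : X) :
    (symbolAt O ρ x).1 * (symbolAt O ρ x).2 = (ρ.stab x).index := by
  rw [symbolAt_fst, symbolAt_snd, index_sup_mul_relIndex]

theorem ncard_orbit_eq_index_stab (ρ : Rep K Ω Γ) (x : X) :
    (MulAction.orbit ρ.1.range x).ncard = (ρ.stab x).index := by
  have orbit_eq : MulAction.orbit ρ.1.range x = Set.range fun g => ρ.1 g • x :=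
    Set.ext fun y => Rep.mem_orbit_range
  rw [orbit_eq]
  refine ncard_range_eq_index _ _ fun a b => ?_
  rw [Rep.mem_stab, eq_comm]
  simp [mul_smul, inv_smul_eq_iff]

theorem symbolAt_mul_pos [Finite X] (O : Subring K) (ρ : Rep K Ω Γ) (x : X) :
    0 < (symbolAt O ρ x).1 * (symbolAt O ρ x).2 := by
  rw [symbolAt_mul, ← ncard_orbit_eq_index_stab, Set.ncard_pos]
  exact MulAction.nonempty_orbit x

end Symbols

namespace ExtensionEquiv

variable {K Ω K' Ω' : Type u} [Field K] [Field Ω] [Algebra K Ω] [Field K'] [Field Ω']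
  [Algebra K' Ω'] {O : Subring K} {O' : Subring K'} {Γ : Type*} [Group Γ]

/-- The isomorphism `F` of Galois groups carries `ρ` to a representation that is conjugate to `ρ'`
by `γ`. -/
def Intertwines (F : ExtensionEquiv O O' Ω Ω') (γ : Γ) (ρ : Rep K Ω Γ) (ρ' : Rep K' Ω' Γ) : Prop :=
  ∀ g, ρ'.1 (F.galEquiv g) = γ * ρ.1 g * γ⁻¹

theorem intertwines_ofGal (O : Subring K) (ρ : Rep K Ω Γ) (g : Gal(Ω/K)) :
    (ofGal O g).Intertwines (ρ.1 g) ρ ρ := fun h => by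
  rw [galEquiv_ofGal, map_mul, map_mul, map_inv]

namespace Intertwines

variable {F : ExtensionEquiv O O' Ω Ω'} {γ : Γ} {ρ : Rep K Ω Γ} {ρ' : Rep K' Ω' Γ}

theorem map {Δ : Type*} [Group Δ] (h : F.Intertwines γ ρ ρ') (φ : Γ →* Δ) :
    F.Intertwines (φ γ) (ρ.map φ) (ρ'.map φ) := fun g => by
  change φ _ = φ _ * φ _ * (φ _)⁻¹
  rw [h g, map_mul, map_mul, map_inv]

theorem bar {A B Y : Type*} [Group A] [Group B] [MulAction B Y] {γ : Wreath A B Y}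
    {ρ : Rep K Ω (Wreath A B Y)} {ρ' : Rep K' Ω' (Wreath A B Y)} (h : F.Intertwines γ ρ ρ') :
    F.Intertwines γ.right (barRep ρ) (barRep ρ') :=
  h.map SemidirectProduct.rightHom

variable {X : Type*} [MulAction Γ X]

theorem galEquiv_mem_stab_iff (h : F.Intertwines γ ρ ρ') {x : X} {g : Gal(Ω/K)} :
    F.galEquiv g ∈ ρ'.stab (γ • x) ↔ g ∈ ρ.stab x := by
  simp [Rep.mem_stab, h g, mul_smul]

theorem map_stab (h : F.Intertwines γ ρ ρ') (x : X) :
    (ρ.stab x).map (F.galEquiv : Gal(Ω/K) →* Gal(Ω'/K')) = ρ'.stab (γ • x) := by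
  refine SetLike.ext (F.galEquiv.surjective.forall.2 fun g => ?_)
  rw [h.galEquiv_mem_stab_iff]
  exact Subgroup.mem_map_iff_mem F.galEquiv.injective

theorem symbolAt_smul (h : F.Intertwines γ ρ ρ') (x : X) :
    symbolAt O' ρ' (γ • x) = symbolAt O ρ x := by
  apply Prod.ext
  · rw [symbolAt_fst, symbolAt_fst, ← F.map_inertia, ← h.map_stab, ← Subgroup.map_sup]
    exact Subgroup.index_map_equiv _ _
  · rw [symbolAt_snd, symbolAt_snd, ← F.map_inertia, ← h.map_stab]
    exact Subgroup.relIndex_map_map_of_injective _ _ F.galEquiv.injective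

theorem smul_mem_orbit_iff (h : F.Intertwines γ ρ ρ') {x y : X} :
    γ • y ∈ MulAction.orbit ρ'.1.range (γ • x) ↔ y ∈ MulAction.orbit ρ.1.range x := by
  rw [Rep.mem_orbit_range, Rep.mem_orbit_range, F.galEquiv.surjective.exists]
  simp [h _, mul_smul]

theorem top_mem_pointField_iff (h : F.Intertwines γ ρ ρ') {x : X} {y : Ω} :
    F.top y ∈ ρ'.pointField (γ • x) ↔ y ∈ ρ.pointField x := by
  simp only [Rep.pointField, IntermediateField.mem_fixedField_iff]
  rw [F.galEquiv.surjective.forall]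
  simp [h.galEquiv_mem_stab_iff, galEquiv_apply_top]

/-- The restriction of an intertwining isomorphism to the fixed fields of the stabilizers
of corresponding points. -/
def pointFieldEquiv (h : F.Intertwines γ ρ ρ') (x : X) :
    ExtensionEquiv (integersIn O (ρ.pointField x)) (integersIn O' (ρ'.pointField (γ • x))) Ω Ω' :=
  let base := F.top.restrict _ _ fun _ => h.top_mem_pointField_iff.symm
  { base := base
    top := F.top
    base_mem_iff := fun _ => top_mem_integersIn_iff (Ω := ρ.pointField x)
      { base := F.base
        top := base
        base_mem_iff := F.base_mem_iff
        top_algebraMap := fun y => Subtype.ext (F.top_algebraMap y) }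
    top_algebraMap := fun _ => rfl }

theorem galRes_galEquiv_pointFieldEquiv (h : F.Intertwines γ ρ ρ') (x : X)
    (g : Gal(Ω/ρ.pointField x)) :
    galRes _ ((h.pointFieldEquiv x).galEquiv g) = F.galEquiv (galRes _ g) :=
  rfl

end Intertwines

end ExtensionEquiv

section Symbols

variable {K Ω : Type u} [Field K] [Field Ω] [Algebra K Ω] {Γ X : Type*} [Group Γ] [MulAction Γ X]

theorem symbolAt_smul (O : Subring K) (ρ : Rep K Ω Γ) (g : Gal(Ω/K)) (x : X) :
    symbolAt O ρ (ρ.1 g • x) = symbolAt O ρ x :=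
  (ExtensionEquiv.intertwines_ofGal O ρ g).symbolAt_smul x

theorem symbolAt_eq_of_mem_orbit (O : Subring K) (ρ : Rep K Ω Γ) {x y : X}
    (h : y ∈ MulAction.orbit ρ.1.range x) : symbolAt O ρ y = symbolAt O ρ x := by
  obtain ⟨g, rfl⟩ := Rep.mem_orbit_range.1 h
  exact symbolAt_smul O ρ g x

end Symbols

section PointField

theorem Rep.stab_isOpen {K Ω Γ X : Type*} [Field K] [Field Ω] [Algebra K Ω] [Group Γ]
    [MulAction Γ X] (ρ : Rep K Ω Γ) (x : X) : IsOpen (ρ.stab x : Set Gal(Ω/K)) := by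
  let _ : TopologicalSpace Γ := ⊥
  have : DiscreteTopology Γ := ⟨rfl⟩
  exact (isOpen_discrete (MulAction.stabilizer Γ x : Set Γ)).preimage ρ.2

variable {K Ω : Type u} [Field K] [Field Ω] [Algebra K Ω] [IsSepClosure K Ω]
  {Γ X : Type*} [Group Γ] [MulAction Γ X]

theorem Rep.fixingSubgroup_pointField (ρ : Rep K Ω Γ) (x : X) :
    (ρ.pointField x).fixingSubgroup = ρ.stab x :=
  InfiniteGalois.fixingSubgroup_fixedField (k := K) (K := Ω) ⟨ρ.stab x, ρ.stab_isClosed x⟩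

instance Rep.finiteDimensional_pointField (ρ : Rep K Ω Γ) (x : X) :
    FiniteDimensional K (ρ.pointField x) := by
  rw [← InfiniteGalois.isOpen_iff_finite]
  change IsOpen ((ρ.pointField x).fixingSubgroup : Set Gal(Ω/K))
  rw [ρ.fixingSubgroup_pointField]
  exact ρ.stab_isOpen x

theorem residueCard_pointField {O : Subring K} (hO : IsLocalField K O) (ρ : Rep K Ω Γ) (x : X) :
    residueCard (integersIn O (ρ.pointField x)) = residueCard O ^ (symbolAt O ρ x).1 := by
  rw [hO.residueCard_integersIn, ρ.fixingSubgroup_pointField, symbolAt_fst]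

end PointField

section OrbitReps

variable {K Ω : Type u} [Field K] [Field Ω] [Algebra K Ω]
  {B Y α : Type*} [Group B] [MulAction B Y]

theorem apply_out_mk (φ : Rep K Ω B) {f : Y → α} (hf : ∀ g j, f (φ.1 g • j) = f j) (i : Y) :
    f (Quotient.mk (MulAction.orbitRel φ.1.range Y) i).out = f i := by
  obtain ⟨g, hg⟩ := Rep.mem_orbit_range.1 (Quotient.mk_out (s := MulAction.orbitRel φ.1.range Y) i)
  rw [← hg, hf]

variable [Fintype Y] [LinearOrder Y]

theorem mem_orbitReps {φ : Rep K Ω B} {j : Y} :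
    j ∈ orbitReps φ ↔ ∀ k ∈ MulAction.orbit φ.1.range j, j ≤ k := by
  simp [orbitReps]

theorem nodup_orbitReps (φ : Rep K Ω B) : (orbitReps φ : List Y).Nodup :=
  Finset.sort_nodup _ _

theorem exists_mem_orbitReps (φ : Rep K Ω B) (j : Y) :
    ∃ i ∈ orbitReps φ, j ∈ MulAction.orbit φ.1.range i := by
  obtain ⟨i, hi, i_le⟩ := (MulAction.orbit φ.1.range j).toFinite.exists_minimalFor id _
    (MulAction.nonempty_orbit j)
  refine ⟨i, mem_orbitReps.2 fun k hk => ?_, MulAction.mem_orbit_symm.1 hi⟩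
  rw [MulAction.orbit_eq_iff.2 hi] at hk
  exact (le_total i k).elim id (i_le hk)

theorem eq_of_mem_orbitReps {φ : Rep K Ω B} {i j : Y} (hi : i ∈ orbitReps φ)
    (hj : j ∈ orbitReps φ) (h : j ∈ MulAction.orbit φ.1.range i) : i = j :=
  le_antisymm (mem_orbitReps.1 hi j h) (mem_orbitReps.1 hj i (MulAction.mem_orbit_symm.1 h))

/-- The canonical representative, that is the least element, of the orbit of `j`. -/
def repOf (φ : Rep K Ω B) (j : Y) : {i : Y // i ∈ orbitReps φ} :=
  ⟨(exists_mem_orbitReps φ j).choose, (exists_mem_orbitReps φ j).choose_spec.1⟩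

theorem mem_orbit_repOf (φ : Rep K Ω B) (j : Y) : j ∈ MulAction.orbit φ.1.range (repOf φ j : Y) :=
  (exists_mem_orbitReps φ j).choose_spec.2

theorem repOf_eq_of_mem_orbit {φ : Rep K Ω B} {i : {i : Y // i ∈ orbitReps φ}} {j : Y}
    (h : j ∈ MulAction.orbit φ.1.range (i : Y)) : repOf φ j = i := by
  refine Subtype.ext (eq_of_mem_orbitReps i.2 (repOf φ j).2 ?_).symm
  rw [← MulAction.orbit_eq_iff.2 h]
  exact MulAction.mem_orbit_symm.1 (mem_orbit_repOf φ j)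

theorem repOf_coe {φ : Rep K Ω B} (i : {i : Y // i ∈ orbitReps φ}) : repOf φ (i : Y) = i :=
  repOf_eq_of_mem_orbit (MulAction.mem_orbit_self _)

theorem repOf_inv_smul (φ : Rep K Ω B) (g : Gal(Ω/K)) (j : Y) :
    repOf φ ((φ.1 g)⁻¹ • j) = repOf φ j := by
  refine repOf_eq_of_mem_orbit ?_
  rw [← map_inv, ← MulAction.orbit_eq_iff.2 (mem_orbit_repOf φ j)]
  exact Rep.mem_orbit_range.2 ⟨g⁻¹, rfl⟩

/-- The canonical representatives correspond to the orbits. -/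
def orbitRepsEquiv (φ : Rep K Ω B) :
    {i : Y // i ∈ orbitReps φ} ≃ MulAction.orbitRel.Quotient φ.1.range Y where
  toFun i := Quotient.mk (MulAction.orbitRel φ.1.range Y) i.1
  invFun o := repOf φ o.out
  left_inv i := repOf_eq_of_mem_orbit (Quotient.mk_out (s := MulAction.orbitRel φ.1.range Y) i.1)
  right_inv o := (Quotient.sound (MulAction.mem_orbit_symm.1 (mem_orbit_repOf φ _))).trans
    (Quotient.out_eq o)

open Classical in
theorem map_orbitReps (φ : Rep K Ω B) {f : Y → α} (hf : ∀ g j, f (φ.1 g • j) = f j) :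
    ((orbitReps φ : List Y) : Multiset Y).map f =
      (Finset.univ : Finset (MulAction.orbitRel.Quotient φ.1.range Y)).val.map
        (fun o => f o.out) := by
  have map_val : (Finset.univ : Finset {i : Y // i ∈ orbitReps φ}).val.map Subtype.val =
      (orbitReps φ : List Y) :=
    (Multiset.Nodup.ext (Finset.univ.nodup.map Subtype.val_injective)
      (Multiset.coe_nodup.2 (nodup_orbitReps φ))).2 (by simp)
  rw [← map_val, Multiset.map_map, ← Multiset.map_univ_val_equiv (orbitRepsEquiv φ),
    Multiset.map_map]
  exact Multiset.map_congr rfl fun i _ => (apply_out_mk φ hf i.1).symm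

theorem repType_eq_map_orbitReps (O : Subring K) (φ : Rep K Ω B) :
    repType Y O φ = ((orbitReps φ : List Y) : Multiset Y).map (symbolAt O φ) :=
  (map_orbitReps φ (symbolAt_smul O φ)).symm

theorem ExtensionEquiv.Intertwines.map_orbitReps_eq {K' Ω' : Type u} [Field K'] [Field Ω']
    [Algebra K' Ω'] {O : Subring K} {O' : Subring K'} {F : ExtensionEquiv O O' Ω Ω'} {b : B}
    {φ : Rep K Ω B} {φ' : Rep K' Ω' B} (h : F.Intertwines b φ φ') {f f' : Y → α}
    (hf' : ∀ g j, f' (φ'.1 g • j) = f' j) (hff' : ∀ j, f' (b • j) = f j) :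
    ((orbitReps φ' : List Y) : Multiset Y).map f' =
      ((orbitReps φ : List Y) : Multiset Y).map f := by
  classical
  have hf (g) (j) : f (φ.1 g • j) = f j := by
    rw [← hff', ← hff' j, ← hf' (F.galEquiv g) (b • j), h g]
    simp [mul_smul]
  rw [map_orbitReps φ' hf', map_orbitReps φ hf]
  let e : MulAction.orbitRel.Quotient φ.1.range Y ≃ MulAction.orbitRel.Quotient φ'.1.range Y :=
    Quotient.congr (MulAction.toPerm b) fun _ _ => h.smul_mem_orbit_iff.symm
  rw [← Multiset.map_univ_val_equiv e, Multiset.map_map]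
  refine Multiset.map_congr rfl fun o _ => ?_
  induction o using Quotient.inductionOn with
  | h i => exact (apply_out_mk φ' hf' (b • i)).trans ((hff' i).trans (apply_out_mk φ hf i).symm)

end OrbitReps

section CountingFunctions

variable {K Ω : Type u} [Field K] [Field Ω] [Algebra K Ω] [IsSepClosure K Ω] {O : Subring K}
  {K' Ω' : Type u} [Field K'] [Field Ω'] [Algebra K' Ω'] [IsSepClosure K' Ω'] {O' : Subring K'}

theorem IsCountingFunction.eq_of_intertwines {Γ : Type*} [Group Γ] {c : RepFunction.{u} Γ}
    (hc : IsCountingFunction c) (hO : IsLocalField K O) (hO' : IsLocalField K' O')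
    {F : ExtensionEquiv O O' Ω Ω'} {γ : Γ} {ρ : Rep K Ω Γ} {ρ' : Rep K' Ω' Γ}
    (h : F.Intertwines γ ρ ρ') : c K' Ω' O' ρ' = c K Ω O ρ := by
  have map_base : O.map (F.base : K →+* K') = O' := by
    ext y
    obtain ⟨x, rfl⟩ := F.base.surjective y
    simp [F.base_mem_iff]
  rw [← hc.conj_eq K Ω O hO ρ γ]
  refine (hc.iso_eq K Ω O K' Ω' O' hO hO' F.base F.top map_base F.top_algebraMap _ _
    fun g g' hg => ?_).symm
  rw [F.eq_galEquiv_iff.2 hg, h g]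
  rfl

theorem isCountingFunction_of_intertwines {Γ : Type*} [Group Γ] {c : RepFunction.{u} Γ}
    (h : ∀ (K Ω : Type u) [Field K] [Field Ω] [Algebra K Ω] [IsSepClosure K Ω] (O : Subring K)
      (K' Ω' : Type u) [Field K'] [Field Ω'] [Algebra K' Ω'] [IsSepClosure K' Ω'] (O' : Subring K'),
      IsLocalField K O → IsLocalField K' O' → ∀ (F : ExtensionEquiv O O' Ω Ω') (γ : Γ)
        (ρ : Rep K Ω Γ) (ρ' : Rep K' Ω' Γ), F.Intertwines γ ρ ρ' → c K' Ω' O' ρ' = c K Ω O ρ) :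
    IsCountingFunction c where
  conj_eq K Ω _ _ _ _ O hO ρ γ := by
    refine h K Ω O K Ω O hO hO (.ofGal O 1) γ ρ _ fun g => ?_
    rw [ExtensionEquiv.galEquiv_ofGal, one_mul, inv_one, mul_one]
    rfl
  iso_eq K Ω _ _ _ _ O K' Ω' _ _ _ _ O' hO hO' e E hOO' hE ρ ρ' hρ := by
    let F : ExtensionEquiv O O' Ω Ω' :=
      { base := e
        top := E
        base_mem_iff := fun x => by simp [← hOO']
        top_algebraMap := hE }
    refine (h K Ω O K' Ω' O' hO hO' F 1 ρ ρ' fun g => ?_).symm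
    rw [one_mul, inv_one, mul_one, hρ g _ (F.eq_galEquiv_iff.1 rfl)]

variable {A B Y : Type*} [Group A] [Group B] [MulAction B Y]

theorem Wreath.mul_left_apply (v w : Wreath A B Y) (j : Y) :
    (v * w).left j = v.left j * w.left (v.right⁻¹ • j) :=
  rfl

theorem Wreath.inv_left_apply (w : Wreath A B Y) (j : Y) :
    w⁻¹.left j = (w.left (w.right • j))⁻¹ := by
  have h := Wreath.mul_left_apply w w⁻¹ (w.right • j)
  rw [mul_inv_cancel, inv_smul_smul] at h
  exact eq_inv_of_mul_eq_one_right h.symm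

theorem Wreath.conj_left_apply (γ w : Wreath A B Y) (j : Y) (h : w.right • j = j) :
    (γ * w * γ⁻¹).left (γ.right • j) =
      γ.left (γ.right • j) * w.left j * (γ.left (γ.right • j))⁻¹ := by
  have fixed : γ.right • (γ * w).right⁻¹ • γ.right • j = γ.right • j := by
    rw [SemidirectProduct.mul_right, mul_inv_rev, mul_smul, inv_smul_smul, inv_smul_eq_iff.2 h.symm]
  rw [Wreath.mul_left_apply, Wreath.mul_left_apply, Wreath.inv_left_apply, fixed, inv_smul_smul]

namespace ExtensionEquiv.Intertwines

variable {F : ExtensionEquiv O O' Ω Ω'} {γ : Wreath A B Y} {ρ : Rep K Ω (Wreath A B Y)}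
  {ρ' : Rep K' Ω' (Wreath A B Y)}

theorem point (h : F.Intertwines γ ρ ρ') (j : Y) :
    (h.bar.pointFieldEquiv j).Intertwines (γ.left (γ.right • j)) (pointRep ρ j)
      (pointRep ρ' (γ.right • j)) := fun g => by
  change (ρ'.1 (galRes _ ((h.bar.pointFieldEquiv j).galEquiv g))).left (γ.right • j) = _
  rw [galRes_galEquiv_pointFieldEquiv, h, Wreath.conj_left_apply]
  · rfl
  · exact galRes_mem_stab (barRep ρ) j g

theorem count_pointRep (h : F.Intertwines γ ρ ρ') (hO : IsLocalField K O)
    (hO' : IsLocalField K' O') {cA : RepFunction.{u} A} (hcA : IsCountingFunction cA) (j : Y) :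
    cA _ Ω' (integersIn O' _) (pointRep ρ' (γ.right • j)) =
      cA _ Ω (integersIn O _) (pointRep ρ j) :=
  hcA.eq_of_intertwines (isLocalField_integersIn hO _) (isLocalField_integersIn hO' _)
    (h.point j)

end ExtensionEquiv.Intertwines

theorem isCountingFunction_wreathCount [Fintype Y] [LinearOrder Y] {cA : RepFunction.{u} A}
    (hcA : IsCountingFunction cA) {cB : RepFunction.{u} B} (hcB : IsCountingFunction cB) :
    IsCountingFunction (wreathCount Y cA cB) := by
  refine isCountingFunction_of_intertwines ?_
  intro K Ω _ _ _ _ O K' Ω' _ _ _ _ O' hO hO' F γ ρ ρ' h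
  refine congrArg₂ (· + ·) (hcB.eq_of_intertwines hO hO' h.bar)
    (congrArg Multiset.sum (h.bar.map_orbitReps_eq (fun g j => ?_) fun j => ?_))
  · have self : (ExtensionEquiv.ofGal O' g).Intertwines (ρ'.1 g) ρ' ρ' :=
      ExtensionEquiv.intertwines_ofGal O' ρ' g
    exact congrArg₂ (·.1 * ·) (self.bar.symbolAt_smul j) (self.count_pointRep hO' hO' hcA j)
  · exact congrArg₂ (·.1 * ·) (h.bar.symbolAt_smul j) (h.count_pointRep hO hO' hcA j)

theorem isCountingFunction_prodCount {cA : RepFunction.{u} A} (hcA : IsCountingFunction cA)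
    {cB : RepFunction.{u} B} (hcB : IsCountingFunction cB) :
    IsCountingFunction (prodCount cA cB) :=
  isCountingFunction_of_intertwines fun _ _ _ _ _ _ _ _ _ _ _ _ _ _ hO hO' _ _ _ _ h =>
    congrArg₂ (· + ·) (hcA.eq_of_intertwines hO hO' (h.map (MonoidHom.fst A B)))
      (hcB.eq_of_intertwines hO hO' (h.map (MonoidHom.snd A B)))

end CountingFunctions

section Continuity

open Filter Topology

theorem galRes_injective {K Ω : Type*} [Field K] [Field Ω] [Algebra K Ω]
    (L : IntermediateField K Ω) : Function.Injective (galRes L) :=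
  AlgEquiv.restrictScalarsHom_injective K

theorem Rep.range_galRes {K Ω : Type u} {Γ X : Type*} [Field K] [Field Ω] [Algebra K Ω]
    [IsSepClosure K Ω] [Group Γ] [MulAction Γ X] (ρ : Rep K Ω Γ) (x : X) :
    (galRes (ρ.pointField x)).range = ρ.stab x := by
  refine le_antisymm ?_ fun g hg => ?_
  · rintro _ ⟨g, rfl⟩
    exact galRes_mem_stab ρ x g
  · rw [← ρ.fixingSubgroup_pointField] at hg
    exact ⟨IntermediateField.fixingSubgroupEquiv _ ⟨g, hg⟩, rfl⟩

theorem Rep.isOpenEmbedding_galRes {K Ω : Type u} {Γ X : Type*} [Field K] [Field Ω] [Algebra K Ω]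
    [IsSepClosure K Ω] [Group Γ] [MulAction Γ X] (ρ : Rep K Ω Γ) (x : X) :
    IsOpenEmbedding (galRes (ρ.pointField x)) := by
  have : T2Space Gal(Ω/K) := krullTopology_t2
  refine ⟨((galRes_continuous _).isClosedEmbedding (galRes_injective _)).isEmbedding, ?_⟩
  rw [← MonoidHom.coe_range, ρ.range_galRes]
  exact ρ.stab_isOpen x

theorem Rep.eventually_eq_one {K Ω Γ : Type*} [Field K] [Field Ω] [Algebra K Ω] [Group Γ]
    (ρ : Rep K Ω Γ) : ∀ᶠ g in 𝓝 1, ρ.1 g = 1 := by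
  let _ : TopologicalSpace Γ := ⊥
  have : DiscreteTopology Γ := ⟨rfl⟩
  exact ((isOpen_discrete ({1} : Set Γ)).preimage ρ.2).mem_nhds (map_one ρ.1)

theorem continuous_of_eventually_eq_one {G Γ : Type*} [Group G] [TopologicalSpace G]
    [IsTopologicalGroup G] [Group Γ] (f : G →* Γ) (h : ∀ᶠ g in 𝓝 1, f g = 1) :
    @Continuous G Γ _ ⊥ f := by
  let _ : TopologicalSpace Γ := ⊥
  have : DiscreteTopology Γ := ⟨rfl⟩
  refine continuous_of_continuousAt_one f ((continuousAt_const (y := (1 : Γ))).congr ?_)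
  filter_upwards [h] with g hg using hg.symm

end Continuity

section Transporter

variable {K Ω : Type u} [Field K] [Field Ω] [Algebra K Ω]
  {B Y : Type*} [Group B] [MulAction B Y] [Fintype Y] [LinearOrder Y]

open Classical in
/-- A Galois element carrying the canonical representative of the orbit of `j` to `j`. It is
chosen to be `1` when `j` is itself the canonical representative. -/
def transporter (φ : Rep K Ω B) (j : Y) : Gal(Ω/K) :=
  if j ∈ orbitReps φ then 1 else (Rep.mem_orbit_range.1 (mem_orbit_repOf φ j)).choose

theorem transporter_of_mem {φ : Rep K Ω B} {j : Y} (hj : j ∈ orbitReps φ) :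
    transporter φ j = 1 :=
  if_pos hj

theorem transporter_smul_repOf (φ : Rep K Ω B) (j : Y) :
    φ.1 (transporter φ j) • (repOf φ j : Y) = j := by
  rw [transporter]
  split_ifs with h
  · rw [map_one, one_smul, repOf_coe ⟨j, h⟩]
  · exact (Rep.mem_orbit_range.1 (mem_orbit_repOf φ j)).choose_spec

theorem transporter_inv_smul (φ : Rep K Ω B) (j : Y) :
    (φ.1 (transporter φ j))⁻¹ • j = repOf φ j := by
  rw [inv_smul_eq_iff, transporter_smul_repOf]

/-- The element of the stabilizer of the canonical representative of the orbit of `j` that is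
obtained by going to `g⁻¹ j`, then by `g` to `j`, and back. -/
def loop (φ : Rep K Ω B) (g : Gal(Ω/K)) (j : Y) : Gal(Ω/K) :=
  (transporter φ j)⁻¹ * g * transporter φ ((φ.1 g)⁻¹ • j)

theorem loop_mem_stab (φ : Rep K Ω B) (g : Gal(Ω/K)) (j : Y) :
    loop φ g j ∈ φ.stab (repOf φ j : Y) := by
  have h := transporter_smul_repOf φ ((φ.1 g)⁻¹ • j)
  rw [repOf_inv_smul] at h
  rw [Rep.mem_stab, loop, map_mul, map_mul, mul_smul, mul_smul, h, smul_inv_smul, map_inv,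
    transporter_inv_smul]

theorem loop_mul (φ : Rep K Ω B) (g h : Gal(Ω/K)) (j : Y) :
    loop φ (g * h) j = loop φ g j * loop φ h ((φ.1 g)⁻¹ • j) := by
  simp only [loop, map_mul, mul_inv_rev, mul_smul]
  group

theorem transporter_mul_loop (φ : Rep K Ω B) (g : Gal(Ω/K)) (j : Y) :
    transporter φ j * loop φ g j = g * transporter φ ((φ.1 g)⁻¹ • j) := by
  rw [loop]
  group

theorem loop_transporter (φ : Rep K Ω B) (j : Y) : loop φ (transporter φ j) j = 1 := by
  rw [loop, transporter_inv_smul, transporter_of_mem (repOf φ j).2, inv_mul_cancel, one_mul]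

theorem loop_galRes [IsSepClosure K Ω] (φ : Rep K Ω B) (i : {i : Y // i ∈ orbitReps φ})
    (g : Gal(Ω/φ.pointField (i : Y))) : loop φ (galRes _ g) (i : Y) = galRes _ g := by
  rw [loop, inv_smul_eq_iff.2 (galRes_mem_stab φ i.1 g).symm, transporter_of_mem i.2, inv_one,
    one_mul, mul_one]

end Transporter

section Lifts

variable {K Ω : Type u} [Field K] [Field Ω] [Algebra K Ω]
  {A B Y : Type*} [Group A] [Group B] [MulAction B Y]

/-- The lifts of `φ` to the wreath product. -/
abbrev Lifts (A : Type*) [Group A] (φ : Rep K Ω B) (Y : Type*) [MulAction B Y] :=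
  {ρ : Rep K Ω (Wreath A B Y) // barRep ρ = φ}

namespace Lifts

variable {φ : Rep K Ω B} (ρ : Lifts A φ Y)

theorem right_apply (g : Gal(Ω/K)) : (ρ.1.1 g).right = φ.1 g := by
  obtain ⟨ρ, rfl⟩ := ρ
  rfl

theorem left_mul (g h : Gal(Ω/K)) (j : Y) :
    (ρ.1.1 (g * h)).left j = (ρ.1.1 g).left j * (ρ.1.1 h).left ((φ.1 g)⁻¹ • j) := by
  rw [map_mul, Wreath.mul_left_apply, right_apply]

variable [IsSepClosure K Ω]

/-- The representation `ρ_j` of a lift `ρ` of `φ`, over the fixed field defined by `φ`. -/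
def point (j : Y) : Rep (φ.pointField j) Ω A :=
  ρ.2 ▸ pointRep ρ.1 j

theorem point_apply (j : Y) (g : Gal(Ω/φ.pointField j)) :
    (ρ.point j).1 g = (ρ.1.1 (galRes _ g)).left j := by
  obtain ⟨ρ, rfl⟩ := ρ
  rfl

end Lifts

variable [Fintype Y] [LinearOrder Y]

/-- The data that determine a lift `ρ` of `φ`: the representations `ρ_i` for the canonical
representatives `i`, and for every other point `j` the value in `A` at `j` of the transporter
to `j`. -/
abbrev LiftData (A : Type*) [Group A] (φ : Rep K Ω B) (Y : Type*) [MulAction B Y] [Fintype Y]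
    [LinearOrder Y] :=
  (∀ i : {i : Y // i ∈ orbitReps φ}, Rep (φ.pointField i.1) Ω A) ×
    ({j : Y // j ∉ orbitReps φ} → A)

namespace LiftData

variable {φ : Rep K Ω B} (d : LiftData A φ Y)

/-- The value in `A` at `j` of the transporter to `j`, which is `1` if `j` is a canonical
representative. -/
def edge : Y → A :=
  Function.extend Subtype.val d.2 1

theorem edge_coe (j : {j : Y // j ∉ orbitReps φ}) : d.edge j = d.2 j :=
  Subtype.val_injective.extend_apply _ _ j

theorem edge_of_mem {j : Y} (h : j ∈ orbitReps φ) : d.edge j = 1 :=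
  Function.extend_apply' _ _ _ fun ⟨k, hk⟩ => k.2 (hk ▸ h)

/-- The representation `ρ_i`, as a function on the whole Galois group that is `1` outside of the
stabilizer of `i`. -/
def pointFun (i : {i : Y // i ∈ orbitReps φ}) : Gal(Ω/K) → A :=
  Function.extend (galRes _) (d.1 i).1 1

theorem pointFun_galRes (i : {i : Y // i ∈ orbitReps φ}) (g : Gal(Ω/φ.pointField i.1)) :
    d.pointFun i (galRes _ g) = (d.1 i).1 g :=
  (galRes_injective _).extend_apply _ _ g

theorem pointFun_one (i : {i : Y // i ∈ orbitReps φ}) : d.pointFun i 1 = 1 := by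
  rw [← map_one (galRes _), pointFun_galRes, map_one]

variable [IsSepClosure K Ω]

theorem pointFun_mul (i : {i : Y // i ∈ orbitReps φ}) {g h : Gal(Ω/K)} (hg : g ∈ φ.stab i.1)
    (hh : h ∈ φ.stab i.1) : d.pointFun i (g * h) = d.pointFun i g * d.pointFun i h := by
  rw [← φ.range_galRes] at hg hh
  obtain ⟨g, rfl⟩ := hg
  obtain ⟨h, rfl⟩ := hh
  simp only [← map_mul, pointFun_galRes]

open Filter Topology in
theorem eventually_pointFun_eq_one (i : {i : Y // i ∈ orbitReps φ}) :
    ∀ᶠ g in 𝓝 1, d.pointFun i g = 1 := by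
  rw [← map_one (galRes (φ.pointField i.1)), ← (φ.isOpenEmbedding_galRes i.1).map_nhds_eq,
    eventually_map]
  simp only [pointFun_galRes]
  exact (d.1 i).eventually_eq_one

/-- The homomorphism to the wreath product that is determined by the given data. -/
def toHom : Gal(Ω/K) →* Wreath A B Y :=
  MonoidHom.mk' (fun g => ⟨fun j => d.edge j * d.pointFun (repOf φ j) (loop φ g j) *
    (d.edge ((φ.1 g)⁻¹ • j))⁻¹, φ.1 g⟩) fun g h => by
      refine SemidirectProduct.ext (funext fun j => ?_) (map_mul _ _ _)
      have hh := loop_mem_stab φ h ((φ.1 g)⁻¹ • j)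
      rw [repOf_inv_smul] at hh
      rw [Wreath.mul_left_apply]
      dsimp only
      rw [loop_mul, d.pointFun_mul _ (loop_mem_stab φ g j) hh, repOf_inv_smul, map_mul,
        mul_inv_rev, mul_smul]
      group

theorem toHom_left (g : Gal(Ω/K)) (j : Y) :
    (d.toHom g).left j = d.edge j * d.pointFun (repOf φ j) (loop φ g j) *
      (d.edge ((φ.1 g)⁻¹ • j))⁻¹ :=
  rfl

open Filter Topology in
theorem continuous_toHom : @Continuous Gal(Ω/K) (Wreath A B Y) _ ⊥ d.toHom := by
  have conj_eq_one (j : Y) : ∀ᶠ g in 𝓝 1,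
      d.pointFun (repOf φ j) ((transporter φ j)⁻¹ * g * transporter φ j) = 1 := by
    have conj : Tendsto (fun g => (transporter φ j)⁻¹ * g * transporter φ j) (𝓝 1) (𝓝 1) :=
      Continuous.tendsto' (by fun_prop) _ _ (by simp)
    exact conj.eventually (d.eventually_pointFun_eq_one (repOf φ j))
  refine continuous_of_eventually_eq_one _ ?_
  filter_upwards [φ.eventually_eq_one, eventually_all.2 conj_eq_one] with g hφ hg
  refine SemidirectProduct.ext (funext fun j => ?_) hφ
  rw [toHom_left, loop, hφ, inv_one, one_smul, hg, mul_one, mul_inv_cancel]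
  rfl

/-- The lift that is determined by the given data. -/
def toLift : Lifts A φ Y :=
  ⟨⟨d.toHom, d.continuous_toHom⟩, rfl⟩

end LiftData

variable [IsSepClosure K Ω] {φ : Rep K Ω B}

/-- The data of a lift. -/
def Lifts.data (ρ : Lifts A φ Y) : LiftData A φ Y :=
  (fun i => ρ.point i.1, fun j => (ρ.1.1 (transporter φ j.1)).left j.1)

theorem Lifts.edge_data (ρ : Lifts A φ Y) (j : Y) :
    ρ.data.edge j = (ρ.1.1 (transporter φ j)).left j := by
  by_cases hj : j ∈ orbitReps φ
  · rw [ρ.data.edge_of_mem hj, transporter_of_mem hj, map_one]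
    rfl
  · exact ρ.data.edge_coe ⟨j, hj⟩

theorem Lifts.pointFun_data (ρ : Lifts A φ Y) (i : {i : Y // i ∈ orbitReps φ}) {g : Gal(Ω/K)}
    (hg : g ∈ φ.stab i.1) : ρ.data.pointFun i g = (ρ.1.1 g).left i.1 := by
  rw [← φ.range_galRes] at hg
  obtain ⟨g, rfl⟩ := hg
  exact (ρ.data.pointFun_galRes i g).trans (ρ.point_apply i.1 g)

theorem Lifts.toLift_data (ρ : Lifts A φ Y) : ρ.data.toLift = ρ := by
  refine Subtype.ext (Subtype.ext (MonoidHom.ext fun g => SemidirectProduct.ext (funext fun j => ?_)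
    (ρ.right_apply g).symm))
  have h := congrArg (fun x => (ρ.1.1 x).left j) (transporter_mul_loop φ g j)
  simp only [left_mul, transporter_inv_smul] at h
  refine (ρ.data.toHom_left g j).trans ?_
  rw [ρ.pointFun_data _ (loop_mem_stab φ g j), edge_data, edge_data, h, mul_inv_cancel_right]

theorem LiftData.data_toLift (d : LiftData A φ Y) : d.toLift.data = d := by
  refine Prod.ext (funext fun i => Subtype.ext (MonoidHom.ext fun g => ?_)) (funext fun j => ?_)
  · refine (d.toLift.point_apply i.1 g).trans ((d.toHom_left _ _).trans ?_)
    rw [loop_galRes, repOf_coe, pointFun_galRes, inv_smul_eq_iff.2 (galRes_mem_stab φ i.1 g).symm,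
      d.edge_of_mem i.2, one_mul, inv_one, mul_one]
  · refine (d.toHom_left _ _).trans ?_
    rw [loop_transporter, pointFun_one, transporter_inv_smul, d.edge_of_mem (repOf φ j.1).2,
      edge_coe, mul_one, inv_one, mul_one]

/-- Lifts of `φ` to the wreath product correspond to families of representations of the stabilizers
of the canonical representatives, together with one element of `A` for each other point. -/
def liftsEquiv (A : Type*) [Group A] (φ : Rep K Ω B) : Lifts A φ Y ≃ LiftData A φ Y where
  toFun := Lifts.data
  invFun := fun d => d.toLift
  left_inv := Lifts.toLift_data
  right_inv := fun d => d.data_toLift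

end Lifts

section Sums

theorem hasSum_sigma_of_nonneg {α : Type*} {β : α → Type*} {f : (Σ x, β x) → ℝ} {g : α → ℝ}
    {a : ℝ} (hf : ∀ x, 0 ≤ f x) (h : ∀ x, HasSum (fun y => f ⟨x, y⟩) (g x)) (hg : HasSum g a) :
    HasSum f a := by
  have hs : Summable f := (summable_sigma_of_nonneg hf).2
    ⟨fun x => (h x).summable, by simpa only [(h _).tsum_eq] using hg.summable⟩
  exact (hs.hasSum.sigma h).unique hg ▸ hs.hasSum

theorem hasSum_prod_mul {α β : Type*} {f : α → ℝ} {g : β → ℝ} {a b : ℝ} (hf : HasSum f a)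
    (hg : HasSum g b) : HasSum (fun x : α × β => f x.1 * g x.2) (a * b) :=
  hf.mul hg (summable_mul_of_summable_norm hf.summable.norm hg.summable.norm)

theorem hasSum_prod_fst {α : Type*} (β : Type*) [Finite β] {f : α → ℝ} {a : ℝ}
    (hf : HasSum f a) : HasSum (fun x : α × β => f x.1) (Nat.card β * a) := by
  have := Fintype.ofFinite β
  simpa [mul_comm] using hasSum_prod_mul hf (hasSum_fintype fun _ : β => (1 : ℝ))

theorem hasSum_pi_prod.{v, w} {ι : Type v} [Fintype ι] (R : ι → Type w) (f : ∀ i, R i → ℝ)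
    (a : ι → ℝ) (h : ∀ i, HasSum (f i) (a i)) :
    HasSum (fun x : ∀ i, R i => ∏ i, f i (x i)) (∏ i, a i) := by
  let P (ι : Type v) [Fintype ι] : Prop := ∀ (R : ι → Type w) (f : ∀ i, R i → ℝ) (a : ι → ℝ),
    (∀ i, HasSum (f i) (a i)) → HasSum (fun x : ∀ i, R i => ∏ i, f i (x i)) (∏ i, a i)
  suffices P ι from this R f a h
  refine Fintype.induction_empty_option (P := P) ?_ ?_ ?_ ι
  · intro α β _ e ih R f a h
    let _ := Fintype.ofEquiv β e.symm
    rw [← (Equiv.piCongrLeft R e).hasSum_iff, ← e.prod_comp]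
    convert ih _ _ _ fun i => h (e i) using 2 with x
    simp [← e.prod_comp, Equiv.piCongrLeft_apply_apply]
  · intro R f a _
    simp
  · intro α _ ih R f a h
    rw [← Equiv.piOptionEquivProd.symm.hasSum_iff, Fintype.prod_option]
    simpa [Function.comp_def, Fintype.prod_option] using
      hasSum_prod_mul (h none) (ih _ _ _ fun i => h (some i))

end Sums

section SameTerms

variable {α β ι : Type*} [DecidableEq α]

/-- Two lists of labelled terms have the same terms with each label, in the same order. This is
the relation between `wreathTerms` and the wreath type in `HasWreathType`. -/
def SameTerms (P T : List (α × β)) : Prop :=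
  ∀ s : α, P.filter (fun t => t.1 = s) = T.filter (fun t => t.1 = s)

namespace SameTerms

variable {P T U : List (α × β)}

theorem refl (P : List (α × β)) : SameTerms P P :=
  fun _ => rfl

theorem symm (h : SameTerms P T) : SameTerms T P :=
  fun s => (h s).symm

theorem trans (h : SameTerms P T) (h' : SameTerms T U) : SameTerms P U :=
  fun s => (h s).trans (h' s)

theorem cons (t : α × β) (h : SameTerms P T) : SameTerms (t :: P) (t :: T) :=
  fun s => by rw [List.filter_cons, List.filter_cons, h s]

theorem swap {t u : α × β} (htu : t.1 ≠ u.1) (P : List (α × β)) :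
    SameTerms (t :: u :: P) (u :: t :: P) := by
  intro s
  simp only [List.filter_cons, decide_eq_true_eq]
  split_ifs with ht hu hu
  · exact absurd (ht.trans hu.symm) htu
  all_goals rfl

theorem perm (h : SameTerms P T) : P.Perm T := by
  classical
  refine List.perm_iff_count.2 fun x => ?_
  simpa [List.count_filter] using congrArg (List.count x) (h x.1)

end SameTerms

theorem exists_sameTerms_of_perm {l : List α} {T : List (α × β)} (h : (T.map Prod.fst).Perm l) :
    ∃ P : List (α × β), P.map Prod.fst = l ∧ SameTerms P T := by
  generalize hk : T.map Prod.fst = k at h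
  induction h generalizing T with
  | nil => exact ⟨T, hk, .refl T⟩
  | cons x _ ih =>
    obtain ⟨⟨_, b⟩, T, rfl, rfl, hT⟩ := List.map_eq_cons_iff.1 hk
    obtain ⟨P, hP, hPT⟩ := ih hT
    exact ⟨(_, b) :: P, by rw [List.map_cons, hP], hPT.cons _⟩
  | swap x y l =>
    by_cases hxy : x = y
    · exact ⟨T, by rw [hk, hxy], .refl T⟩
    · obtain ⟨t, T, rfl, rfl, hT⟩ := List.map_eq_cons_iff.1 hk
      obtain ⟨u, T, rfl, rfl, rfl⟩ := List.map_eq_cons_iff.1 hT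
      exact ⟨u :: t :: T, rfl, .swap hxy T⟩
  | trans _ _ ih₁ ih₂ =>
    obtain ⟨P, hP, hPT⟩ := ih₁ hk
    obtain ⟨Q, hQ, hQP⟩ := ih₂ hP
    exact ⟨Q, hQ, hQP.trans hPT⟩

theorem exists_map_eq_of_nodup [Nonempty β] {l : List ι} (hl : l.Nodup) {P : List β}
    (h : l.length = P.length) : ∃ τ : ι → β, l.map τ = P := by
  classical
  refine ⟨fun i => P.getD (l.idxOf i) (Classical.arbitrary β), ?_⟩
  refine List.ext_getElem (by rw [List.length_map, h]) fun n h₁ h₂ => ?_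
  rw [List.getElem_map, List.Nodup.idxOf_getElem hl, List.getD_eq_getElem _ _ h₂]

theorem exists_sameTerms_map [Nonempty β] {s : ι → α} {l : List ι} {T : List (α × β)}
    (hl : l.Nodup) (h : (l.map s).Perm (T.map Prod.fst)) :
    ∃ τ : ι → β, SameTerms (l.map fun i => (s i, τ i)) T := by
  obtain ⟨P, hP, hPT⟩ := exists_sameTerms_of_perm h.symm
  have hlen : l.length = P.length := by simpa using (congrArg List.length hP).symm
  obtain ⟨τ, hτ⟩ := exists_map_eq_of_nodup hl (P := P.map Prod.snd) (by rwa [List.length_map])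
  refine ⟨τ, ?_⟩
  rwa [← List.zip_map', ← List.zip_of_prod hP hτ.symm]

theorem sameTerms_map_iff {s : ι → α} {l : List ι} {τ τ' : ι → β} :
    SameTerms (l.map fun i => (s i, τ i)) (l.map fun i => (s i, τ' i)) ↔
      ∀ i ∈ l, τ i = τ' i := by
  refine ⟨fun h i hi => ?_, fun h s => by rw [List.map_congr_left fun i hi => by rw [h i hi]]⟩
  have hs := h (s i)
  rw [List.filter_map, List.filter_map] at hs
  exact congrArg Prod.snd (List.map_inj_left.1 hs i (by simp [hi]))

end SameTerms

section WreathMass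

variable {K Ω : Type u} [Field K] [Field Ω] [Algebra K Ω]
  {A B X Y : Type*} [Group B] [MulAction B Y] [Fintype Y] [LinearOrder Y]

theorem sum_orbitReps {M : Type*} [AddCommMonoid M] (φ : Rep K Ω B) (g : Y → M) :
    ((orbitReps φ).map g).sum = ∑ i : {i : Y // i ∈ orbitReps φ}, g i := by
  rw [← List.sum_toFinset _ (nodup_orbitReps φ)]
  exact Finset.sum_subtype _ (by simp) g

theorem prod_orbitReps {M : Type*} [CommMonoid M] (φ : Rep K Ω B) (g : Y → M) :
    ((orbitReps φ).map g).prod = ∏ i : {i : Y // i ∈ orbitReps φ}, g i := by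
  rw [← List.prod_toFinset _ (nodup_orbitReps φ)]
  exact Finset.prod_subtype _ (by simp) g

theorem card_notMem_orbitReps (φ : Rep K Ω B) :
    Nat.card {j : Y // j ∉ orbitReps φ} = Fintype.card Y - (orbitReps φ : List Y).length := by
  classical
  rw [Nat.card_eq_fintype_card, Fintype.card_subtype_compl, Fintype.card_subtype,
    ← List.toFinset_card_of_nodup (nodup_orbitReps φ)]
  congr 2
  ext
  simp

variable [IsSepClosure K Ω] [Group A]

theorem Lifts.wreathCount_eq (cA : RepFunction.{u} A) (cB : RepFunction.{u} B) (O : Subring K)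
    {φ : Rep K Ω B} (ρ : Lifts A φ Y) :
    wreathCount Y cA cB K Ω O ρ.1 = cB K Ω O φ + ∑ i : {i : Y // i ∈ orbitReps φ},
      (symbolAt O φ i.1).1 * cA (φ.pointField i.1) Ω (integersIn O _) (ρ.point i.1) := by
  obtain ⟨ρ, rfl⟩ := ρ
  exact congrArg (_ + ·) (sum_orbitReps _ _)

theorem Lifts.inv_pow_wreathCount (cA : RepFunction.{u} A) (cB : RepFunction.{u} B)
    {O : Subring K} (hO : IsLocalField K O) {φ : Rep K Ω B} (ρ : Lifts A φ Y) :
    ((residueCard O : ℝ) ^ wreathCount Y cA cB K Ω O ρ.1)⁻¹ =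
      ((residueCard O : ℝ) ^ cB K Ω O φ)⁻¹ * ∏ i : {i : Y // i ∈ orbitReps φ},
        ((residueCard (integersIn O (φ.pointField i.1)) : ℝ) ^
          cA (φ.pointField i.1) Ω (integersIn O _) (ρ.point i.1))⁻¹ := by
  rw [ρ.wreathCount_eq, pow_add, mul_inv, Finset.prod_inv_distrib, ← Finset.prod_pow_eq_pow_sum]
  simp only [residueCard_pointField hO, pow_mul, Nat.cast_pow]

variable [MulAction A X] [Fintype X]

theorem Lifts.wreathTerms_eq (O : Subring K) {φ : Rep K Ω B} (ρ : Lifts A φ Y) :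
    wreathTerms X O ρ.1 = (orbitReps φ).map fun i =>
      (symbolAt O φ i, repType X (integersIn O (φ.pointField i)) (ρ.point i)) := by
  obtain ⟨ρ, rfl⟩ := ρ
  rfl

theorem hasWreathType_iff_sameTerms {O : Subring K} {ρ : Rep K Ω (Wreath A B Y)}
    {T : List ((ℕ × ℕ) × Multiset (ℕ × ℕ))} :
    HasWreathType X O ρ T ↔ SameTerms (wreathTerms X O ρ) T :=
  Iff.rfl

theorem HasWreathType.repType_barRep {O : Subring K} {ρ : Rep K Ω (Wreath A B Y)}
    {T : List ((ℕ × ℕ) × Multiset (ℕ × ℕ))} (h : HasWreathType X O ρ T) :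
    repType Y O (barRep ρ) = Multiset.ofList (T.map Prod.fst) := by
  have := (hasWreathType_iff_sameTerms.1 h).perm.map Prod.fst
  rw [wreathTerms, List.map_map] at this
  rw [repType_eq_map_orbitReps, Multiset.map_coe, Multiset.coe_eq_coe]
  exact this

theorem Lifts.hasWreathType_iff {O : Subring K} {φ : Rep K Ω B}
    {T : List ((ℕ × ℕ) × Multiset (ℕ × ℕ))} {τ : Y → Multiset (ℕ × ℕ)}
    (hτ : SameTerms ((orbitReps φ).map fun i => (symbolAt O φ i, τ i)) T) (ρ : Lifts A φ Y) :
    HasWreathType X O ρ.1 T ↔ ∀ i : {i : Y // i ∈ orbitReps φ},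
      repType X (integersIn O (φ.pointField i.1)) (ρ.point i.1) = τ i := by
  rw [hasWreathType_iff_sameTerms, ρ.wreathTerms_eq, Subtype.forall]
  exact ⟨fun h => sameTerms_map_iff.1 (h.trans hτ.symm),
    fun h => (sameTerms_map_iff.2 h).trans hτ⟩

/-- The lifts of `φ` of a given wreath type correspond to families of representations `ρ_i` of
given types, together with one element of `A` for each point that is not a canonical
representative. -/
def liftsOfTypeEquiv (A X : Type*) [Group A] [MulAction A X] [Fintype X] {O : Subring K}
    {φ : Rep K Ω B} {T : List ((ℕ × ℕ) × Multiset (ℕ × ℕ))} {τ : Y → Multiset (ℕ × ℕ)}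
    (hτ : SameTerms ((orbitReps φ).map fun i => (symbolAt O φ i, τ i)) T) :
    {ρ : Lifts A φ Y // HasWreathType X O ρ.1 T} ≃
      (∀ i : {i : Y // i ∈ orbitReps φ},
        {ψ : Rep (φ.pointField i.1) Ω A // repType X (integersIn O _) ψ = τ i}) ×
      ({j : Y // j ∉ orbitReps φ} → A) :=
  ((liftsEquiv A φ).subtypeEquiv fun ρ => ρ.hasWreathType_iff hτ).trans <|
    (Equiv.prodSubtypeFstEquivSubtypeProd
      (p := fun ψ : ∀ i : {i : Y // i ∈ orbitReps φ}, Rep (φ.pointField i.1) Ω A =>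
        ∀ i, repType X (integersIn O _) (ψ i) = τ i)).trans <|
      (Equiv.subtypePiEquivPi (p := fun (i : {i : Y // i ∈ orbitReps φ})
        (ψ : Rep (φ.pointField i.1) Ω A) => repType X (integersIn O _) ψ = τ i)).prodCongr
          (Equiv.refl _)

theorem liftsOfTypeEquiv_fst {O : Subring K} {φ : Rep K Ω B}
    {T : List ((ℕ × ℕ) × Multiset (ℕ × ℕ))} {τ : Y → Multiset (ℕ × ℕ)}
    (hτ : SameTerms ((orbitReps φ).map fun i => (symbolAt O φ i, τ i)) T)
    (ρ : {ρ : Lifts A φ Y // HasWreathType X O ρ.1 T}) (i : {i : Y // i ∈ orbitReps φ}) :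
    ((liftsOfTypeEquiv A X hτ ρ).1 i).1 = ρ.1.point i.1 :=
  rfl

theorem prod_terms_eq {O : Subring K} (hO : IsLocalField K O) {φ : Rep K Ω B}
    {T : List ((ℕ × ℕ) × Multiset (ℕ × ℕ))} {τ : Y → Multiset (ℕ × ℕ)}
    (hτ : SameTerms ((orbitReps φ).map fun i => (symbolAt O φ i, τ i)) T)
    (fA : Multiset (ℕ × ℕ) → Polynomial ℤ) :
    (T.map fun t => Polynomial.aeval (((residueCard O : ℝ) ^ t.1.1)⁻¹) (fA t.2)).prod =
      ∏ i : {i : Y // i ∈ orbitReps φ}, Polynomial.aeval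
        ((residueCard (integersIn O (φ.pointField i.1)) : ℝ)⁻¹) (fA (τ i)) := by
  rw [← (hτ.perm.map _).prod_eq, List.map_map, ← prod_orbitReps φ fun i => Polynomial.aeval
    ((residueCard (integersIn O (φ.pointField i)) : ℝ)⁻¹) (fA (τ i))]
  simp only [Function.comp_def, residueCard_pointField hO, Nat.cast_pow]

theorem hasSum_points {S : FieldClass.{u}} {cA : RepFunction.{u} A}
    {fA : Multiset (ℕ × ℕ) → Polynomial ℤ} (hA : ∀ σ, IsMassFormula X S cA σ (fA σ))
    {O : Subring K} (hO : IsLocalField K O) {φ : Rep K Ω B}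
    (hS : ∀ j : Y, S (φ.pointField j) (integersIn O (φ.pointField j)))
    (τ : Y → Multiset (ℕ × ℕ)) :
    HasSum (fun ψ : ∀ i : {i : Y // i ∈ orbitReps φ},
        {ψ : Rep (φ.pointField i.1) Ω A // repType X (integersIn O _) ψ = τ i} =>
          ∏ i : {i : Y // i ∈ orbitReps φ},
            ((residueCard (integersIn O (φ.pointField i.1)) : ℝ) ^
              cA (φ.pointField i.1) Ω (integersIn O _) (ψ i).1)⁻¹)
      (∏ i : {i : Y // i ∈ orbitReps φ}, Polynomial.aeval
        ((residueCard (integersIn O (φ.pointField i.1)) : ℝ)⁻¹) (fA (τ i))) := by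
  have h := @hasSum_pi_prod _ (List.Subtype.fintype (orbitReps φ)) _ _ _ fun i =>
    hA (τ i.1) (φ.pointField i.1) Ω _ (isLocalField_integersIn hO _) (hS i.1)
  exact h

theorem hasSum_lifts [Finite A] {S : FieldClass.{u}} {cA : RepFunction.{u} A}
    (cB : RepFunction.{u} B) {fA : Multiset (ℕ × ℕ) → Polynomial ℤ}
    (hA : ∀ σ, IsMassFormula X S cA σ (fA σ)) {O : Subring K} (hO : IsLocalField K O)
    {φ : Rep K Ω B} (hS : ∀ j : Y, S (φ.pointField j) (integersIn O (φ.pointField j)))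
    {T : List ((ℕ × ℕ) × Multiset (ℕ × ℕ))}
    (hT : repType Y O φ = Multiset.ofList (T.map Prod.fst)) :
    HasSum (fun ρ : {ρ : Lifts A φ Y // HasWreathType X O ρ.1 T} =>
        ((residueCard O : ℝ) ^ wreathCount Y cA cB K Ω O ρ.1.1)⁻¹)
      (((residueCard O : ℝ) ^ cB K Ω O φ)⁻¹ * ((Nat.card A : ℝ) ^ (Fintype.card Y - T.length) *
        (T.map fun t =>
          Polynomial.aeval (((residueCard O : ℝ) ^ t.1.1)⁻¹) (fA t.2)).prod)) := by
  rw [repType_eq_map_orbitReps, Multiset.map_coe, Multiset.coe_eq_coe] at hT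
  obtain ⟨τ, hτ⟩ := exists_sameTerms_map (nodup_orbitReps φ) hT
  have hlen : (orbitReps φ : List Y).length = T.length := by simpa using hT.length_eq
  have hcard : (Nat.card A : ℝ) ^ (Fintype.card Y - T.length) =
      Nat.card ({j : Y // j ∉ orbitReps φ} → A) := by
    rw [Nat.card_fun, card_notMem_orbitReps, hlen, Nat.cast_pow]
  have hdata := (hasSum_prod_fst ({j : Y // j ∉ orbitReps φ} → A)
    (hasSum_points hA hO hS τ)).mul_left
    ((residueCard O : ℝ) ^ cB K Ω O φ)⁻¹
  rw [← (liftsOfTypeEquiv A X hτ).hasSum_iff] at hdata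
  simpa only [Lifts.inv_pow_wreathCount cA cB hO, hcard, prod_terms_eq hO hτ, Function.comp_def,
    liftsOfTypeEquiv_fst] using hdata

/-- Representations of wreath type `T` are the lifts of wreath type `T` of the representations into
`B` whose type is that prescribed by `T`. -/
def wreathTypeEquiv (A B X Y : Type*) [Group A] [Group B] [MulAction A X] [MulAction B Y]
    [Fintype X] [Fintype Y] [LinearOrder Y] (O : Subring K)
    (T : List ((ℕ × ℕ) × Multiset (ℕ × ℕ))) :
    {ρ : Rep K Ω (Wreath A B Y) // HasWreathType X O ρ T} ≃
      Σ φ : {φ : Rep K Ω B // repType Y O φ = Multiset.ofList (T.map Prod.fst)},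
        {ρ : Lifts A φ.1 Y // HasWreathType X O ρ.1 T} where
  toFun ρ := ⟨⟨barRep ρ.1, ρ.2.repType_barRep⟩, ⟨⟨ρ.1, rfl⟩, ρ.2⟩⟩
  invFun x := ⟨x.2.1.1, x.2.2⟩
  left_inv _ := rfl
  right_inv := by
    rintro ⟨⟨φ, _⟩, ⟨⟨ρ, h⟩, _⟩⟩
    obtain rfl : barRep ρ = φ := h
    rfl

theorem hasSum_wreathType [Finite A] {S : FieldClass.{u}} {cA : RepFunction.{u} A}
    {cB : RepFunction.{u} B} (hS : ContainsPointFields S B Y)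
    {fA fB : Multiset (ℕ × ℕ) → Polynomial ℤ} (hA : ∀ σ, IsMassFormula X S cA σ (fA σ))
    (hB : ∀ σ, IsMassFormula Y S cB σ (fB σ)) {O : Subring K} (hO : IsLocalField K O)
    (hK : S K O) (T : List ((ℕ × ℕ) × Multiset (ℕ × ℕ))) :
    HasSum (fun ρ : {ρ : Rep K Ω (Wreath A B Y) // HasWreathType X O ρ T} =>
        ((residueCard O : ℝ) ^ wreathCount Y cA cB K Ω O ρ.1)⁻¹)
      ((Nat.card A : ℝ) ^ (Fintype.card Y - T.length) *
        Polynomial.aeval ((residueCard O : ℝ)⁻¹) (fB (Multiset.ofList (T.map Prod.fst))) *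
        (T.map fun t =>
          Polynomial.aeval (((residueCard O : ℝ) ^ t.1.1)⁻¹) (fA t.2)).prod) := by
  rw [← (wreathTypeEquiv A B X Y O T).symm.hasSum_iff, mul_right_comm, mul_comm]
  exact hasSum_sigma_of_nonneg (fun _ => inv_nonneg.2 (by positivity))
    (fun φ => hasSum_lifts cB hA hO (hS K Ω O hO hK φ.1) φ.2) ((hB _ K Ω O hO hK).mul_right _)

end WreathMass

section OrbitTransversals

variable {K Ω : Type u} [Field K] [Field Ω] [Algebra K Ω] {Γ X : Type*} [Group Γ] [MulAction Γ X]

/-- `F` is a system of representatives of the orbits of `ρ` on `X`. -/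
def IsOrbitTransversal {ι : Type*} (ρ : Rep K Ω Γ) (F : ι → X) : Prop :=
  ∀ x, ∃! i, x ∈ MulAction.orbit ρ.1.range (F i)

theorem isOrbitTransversal_out (ρ : Rep K Ω Γ) : IsOrbitTransversal ρ
    (Quotient.out : MulAction.orbitRel.Quotient ρ.1.range X → X) := fun x =>
  ⟨Quotient.mk (MulAction.orbitRel ρ.1.range X) x, MulAction.mem_orbit_symm.1
    (Quotient.mk_out (s := MulAction.orbitRel ρ.1.range X) x), fun o ho =>
      (Quotient.out_eq o).symm.trans (Quotient.sound (MulAction.mem_orbit_symm.1 ho))⟩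

variable [Fintype X]

theorem IsOrbitTransversal.repType_eq {ι : Type*} [Fintype ι] {ρ : Rep K Ω Γ} {F : ι → X}
    (hF : IsOrbitTransversal ρ F) (O : Subring K) : repType X O ρ = ∑ i, {symbolAt O ρ (F i)} := by
  classical
  have bijective_mk : Function.Bijective fun i =>
      Quotient.mk (MulAction.orbitRel ρ.1.range X) (F i) := by
    refine ⟨fun i j hij => (hF (F i)).unique (MulAction.mem_orbit_self _) (Quotient.exact hij), ?_⟩
    rintro ⟨x⟩
    obtain ⟨i, hi, -⟩ := hF x
    exact ⟨i, Quotient.sound (MulAction.mem_orbit_symm.1 hi)⟩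
  let e : ι ≃ MulAction.orbitRel.Quotient ρ.1.range X := .ofBijective _ bijective_mk
  calc
    repType X O ρ = ∑ o : MulAction.orbitRel.Quotient ρ.1.range X, {symbolAt O ρ o.out} := by
      rw [repType, ← Multiset.sum_map_singleton (Multiset.map _ _), Multiset.map_map]
      rfl
    _ = ∑ i, {symbolAt O ρ (e i).out} := (e.sum_comp _).symm
    _ = ∑ i, {symbolAt O ρ (F i)} := Finset.sum_congr rfl fun i _ => congrArg _
      (symbolAt_eq_of_mem_orbit O ρ (Quotient.mk_out (s := MulAction.orbitRel ρ.1.range X) (F i)))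

theorem symbolAt_le (O : Subring K) (ρ : Rep K Ω Γ) (x : X) :
    symbolAt O ρ x ≤ (Fintype.card X, Fintype.card X) := by
  have mul_le : (symbolAt O ρ x).1 * (symbolAt O ρ x).2 ≤ Fintype.card X := by
    rw [symbolAt_mul, ← ncard_orbit_eq_index_stab, ← Nat.card_eq_fintype_card]
    exact Set.ncard_le_card _
  have mul_pos := symbolAt_mul_pos O ρ x
  exact ⟨(Nat.le_mul_of_pos_right _ (Nat.pos_of_mul_pos_left mul_pos)).trans mul_le,
    (Nat.le_mul_of_pos_left _ (Nat.pos_of_mul_pos_right mul_pos)).trans mul_le⟩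

end OrbitTransversals

section WreathOrbits

variable {K Ω : Type u} [Field K] [Field Ω] [Algebra K Ω] [IsSepClosure K Ω]
  {A B X Y : Type*} [Group A] [Group B] [MulAction A X] [MulAction B Y]

theorem pointRep_smul (ρ : Rep K Ω (Wreath A B Y)) (i : Y) (x : X)
    (g : Gal(Ω/(barRep ρ).pointField i)) :
    ρ.1 (galRes _ g) • (i, x) = (i, (pointRep ρ i).1 g • x) := by
  have h : (ρ.1 (galRes _ g)).right • i = i := galRes_mem_stab (barRep ρ) i g
  change ((ρ.1 (galRes _ g)).right • i,
    (ρ.1 (galRes _ g)).left ((ρ.1 (galRes _ g)).right • i) • x) = _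
  rw [h]
  rfl

theorem exists_galRes_of_smul_eq {ρ : Rep K Ω (Wreath A B Y)} {i : Y} {x y : X} {g : Gal(Ω/K)}
    (h : ρ.1 g • (i, x) = (i, y)) : ∃ g', galRes _ g' = g ∧ (pointRep ρ i).1 g' • x = y := by
  have hg : g ∈ (barRep ρ).stab i := congrArg Prod.fst h
  rw [← (barRep ρ).range_galRes] at hg
  obtain ⟨g', rfl⟩ := hg
  exact ⟨g', rfl, congrArg Prod.snd ((pointRep_smul ρ i x g').symm.trans h)⟩

theorem mem_orbit_wreath_iff {ρ : Rep K Ω (Wreath A B Y)} {i : Y} {x y : X} :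
    (i, y) ∈ MulAction.orbit ρ.1.range (i, x) ↔ y ∈ MulAction.orbit (pointRep ρ i).1.range x := by
  rw [Rep.mem_orbit_range, Rep.mem_orbit_range]
  constructor
  · rintro ⟨g, hg⟩
    obtain ⟨g', -, h⟩ := exists_galRes_of_smul_eq hg
    exact ⟨g', h⟩
  · rintro ⟨g, rfl⟩
    exact ⟨galRes _ g, pointRep_smul ρ i x g⟩

theorem stab_wreath (ρ : Rep K Ω (Wreath A B Y)) (i : Y) (x : X) :
    ρ.stab (i, x) = ((pointRep ρ i).stab x).map (galRes _) := by
  ext g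
  constructor
  · intro hg
    obtain ⟨g', hg', h⟩ := exists_galRes_of_smul_eq (Rep.mem_stab.1 hg)
    exact ⟨g', h, hg'⟩
  · rintro ⟨g, hg, rfl⟩
    exact (pointRep_smul ρ i x g).trans (congrArg (Prod.mk i) hg)

theorem isOrbitTransversal_wreath [Fintype Y] [LinearOrder Y] (ρ : Rep K Ω (Wreath A B Y))
    {κ : {i : Y // i ∈ orbitReps (barRep ρ)} → Type*} {F : ∀ i, κ i → X}
    (hF : ∀ i, IsOrbitTransversal (pointRep ρ i.1) (F i)) :
    IsOrbitTransversal ρ fun s : Σ i, κ i => (s.1.1, F s.1 s.2) := by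
  rintro ⟨j, y⟩
  obtain ⟨g, hg⟩ := Rep.mem_orbit_range.1 (mem_orbit_repOf (barRep ρ) j)
  obtain ⟨x, hx⟩ : ∃ x, (j, y) ∈ MulAction.orbit ρ.1.range ((repOf (barRep ρ) j).1, x) := by
    refine ⟨((ρ.1 g)⁻¹ • (j, y)).2, Rep.mem_orbit_range.2 ⟨g, ?_⟩⟩
    have fst_eq : ((ρ.1 g)⁻¹ • (j, y)).1 = (repOf (barRep ρ) j).1 := inv_smul_eq_iff.2 hg.symm
    rw [← fst_eq, smul_inv_smul]
  obtain ⟨s, hs, hs_unique⟩ := hF (repOf (barRep ρ) j) x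
  refine ⟨⟨_, s⟩, ?_, ?_⟩
  · rwa [MulAction.orbit_eq_iff.2 (mem_orbit_wreath_iff.2 hs)] at hx
  · rintro ⟨i, t⟩ ht
    obtain ⟨h, hh⟩ := Rep.mem_orbit_range.1 ht
    obtain rfl : repOf (barRep ρ) j = i :=
      repOf_eq_of_mem_orbit (Rep.mem_orbit_range.2 ⟨h, congrArg Prod.fst hh⟩)
    refine congrArg _ (hs_unique t (mem_orbit_wreath_iff.1 ?_))
    rw [← MulAction.orbit_eq_iff.2 ht]
    exact MulAction.mem_orbit_symm.1 hx

end WreathOrbits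

section WreathTypes

theorem inertia_integersIn {K Ω : Type u} [Field K] [Field Ω] [Algebra K Ω] (O : Subring K)
    (L : IntermediateField K Ω) : inertia (integersIn O L) Ω = (inertia O Ω).comap (galRes L) := by
  have key : ∀ (R R' : Subring Ω), R = R' → ∀ g : Gal(Ω/K),
      (∀ x ∈ R, ∃ m ∈ Ideal.jacobson (⊥ : Ideal R), (m : Ω) = g x - x) ↔
        ∀ x ∈ R', ∃ m ∈ Ideal.jacobson (⊥ : Ideal R'), (m : Ω) = g x - x := by
    rintro R _ rfl g
    exact Iff.rfl
  ext g
  exact key _ _ (integersIn_integersIn O L) (galRes L g)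

theorem relIndex_map_eq_mul {G H : Type*} [Group G] [Group H] {f : G →* H}
    (hf : Function.Injective f) (U : Subgroup G) (I : Subgroup H) :
    (U.map f).relIndex I = f.range.relIndex I * U.relIndex (I.comap f) := by
  rw [← Subgroup.relIndex_map_map_of_injective _ _ hf, Subgroup.map_comap_eq, mul_comm,
    Subgroup.relIndex_inf_mul_relIndex, inf_of_le_left (Subgroup.map_le_range f U)]

variable {K Ω : Type u} [Field K] [Field Ω] [Algebra K Ω] [IsSepClosure K Ω]
  {A B X Y : Type*} [Group A] [Group B] [MulAction A X] [MulAction B Y]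

theorem symbolAt_wreath [Finite X] [Finite Y] (O : Subring K) (ρ : Rep K Ω (Wreath A B Y)) (i : Y)
    (x : X) : symbolAt O ρ (i, x) =
      symbolAt O (barRep ρ) i * symbolAt (integersIn O _) (pointRep ρ i) x := by
  have galRes_inj := galRes_injective ((barRep ρ).pointField i)
  have snd_eq : (symbolAt O ρ (i, x)).2 =
      (symbolAt O (barRep ρ) i).2 * (symbolAt (integersIn O _) (pointRep ρ i) x).2 := by
    rw [symbolAt_snd, symbolAt_snd, symbolAt_snd, stab_wreath, relIndex_map_eq_mul galRes_inj,
      Rep.range_galRes, inertia_integersIn]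
  have size_eq : (symbolAt O ρ (i, x)).1 * (symbolAt O ρ (i, x)).2 =
      (symbolAt O (barRep ρ) i).1 * (symbolAt O (barRep ρ) i).2 *
        ((symbolAt (integersIn O _) (pointRep ρ i) x).1 *
          (symbolAt (integersIn O _) (pointRep ρ i) x).2) := by
    rw [symbolAt_mul, symbolAt_mul, symbolAt_mul, stab_wreath,
      Subgroup.index_map_of_injective _ galRes_inj, Rep.range_galRes, mul_comm]
  refine Prod.ext (Nat.eq_of_mul_eq_mul_right
    (Nat.pos_of_mul_pos_left (symbolAt_mul_pos O ρ (i, x))) ?_) snd_eq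
  rw [size_eq, snd_eq, mul_mul_mul_comm]
  rfl

/-- The type of the representations of wreath type `T`. -/
def totalType (T : List ((ℕ × ℕ) × Multiset (ℕ × ℕ))) : Multiset (ℕ × ℕ) :=
  (T.map fun t => t.2.map (t.1 * ·)).sum

variable [Fintype X] [Fintype Y] [LinearOrder Y]

theorem repType_eq_totalType_wreathTerms (O : Subring K) (ρ : Rep K Ω (Wreath A B Y)) :
    repType (Y × X) O ρ = totalType (wreathTerms X O ρ) := by
  classical
  have repType_smul_eq (i : Y) : (repType X (integersIn O _) (pointRep ρ i)).map
      (symbolAt O (barRep ρ) i * ·) =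
        ∑ o : MulAction.orbitRel.Quotient (pointRep ρ i).1.range X, {symbolAt O ρ (i, o.out)} := by
    rw [(isOrbitTransversal_out (pointRep ρ i)).repType_eq, ← Multiset.coe_mapAddMonoidHom, map_sum]
    simp only [symbolAt_wreath, Multiset.coe_mapAddMonoidHom, Multiset.map_singleton]
  have terms_sum : totalType (wreathTerms X O ρ) = ∑ i : {i : Y // i ∈ orbitReps (barRep ρ)},
      (repType X (integersIn O _) (pointRep ρ i.1)).map (symbolAt O (barRep ρ) i.1 * ·) := by
    rw [totalType, wreathTerms, List.map_map]
    exact sum_orbitReps (barRep ρ) _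
  have transversal := isOrbitTransversal_wreath ρ fun i =>
    isOrbitTransversal_out (X := X) (pointRep ρ i.1)
  simp only [terms_sum, repType_smul_eq]
  exact (transversal.repType_eq O).trans (Fintype.sum_sigma _)

end WreathTypes

section Finiteness

theorem finite_setOf_list {α : Type*} {F : Set α} (hF : F.Finite) (n : ℕ) :
    {l : List α | l.length ≤ n ∧ ∀ x ∈ l, x ∈ F}.Finite := by
  have : Finite F := hF
  refine ((List.finite_length_le F n).image (List.map Subtype.val)).subset ?_
  rintro l ⟨hl, h⟩
  lift l to List F using h
  exact ⟨l, by simpa using hl, rfl⟩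

theorem finite_setOf_multiset {α : Type*} {F : Set α} (hF : F.Finite) (n : ℕ) :
    {s : Multiset α | s.card ≤ n ∧ ∀ x ∈ s, x ∈ F}.Finite := by
  refine ((finite_setOf_list hF n).image Multiset.ofList).subset ?_
  rintro ⟨l⟩ h
  exact ⟨l, h, rfl⟩

/-- A finite set that contains the types of all representations on a set with `n` elements. -/
def typeBound (n : ℕ) : Set (Multiset (ℕ × ℕ)) :=
  {σ | σ.card ≤ n ∧ ∀ s ∈ σ, s ∈ Set.Iic (n, n)}

theorem finite_typeBound (n : ℕ) : (typeBound n).Finite :=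
  finite_setOf_multiset (Set.finite_Iic _) n

theorem repType_mem_typeBound {K Ω : Type u} [Field K] [Field Ω] [Algebra K Ω] {Γ X : Type*}
    [Group Γ] [MulAction Γ X] [Fintype X] (O : Subring K) (ρ : Rep K Ω Γ) :
    repType X O ρ ∈ typeBound (Fintype.card X) := by
  classical
  constructor
  · rw [repType, Multiset.card_map]
    exact Fintype.card_le_of_surjective _ Quotient.mk_surjective
  · intro s hs
    obtain ⟨o, -, rfl⟩ := Multiset.mem_map.1 hs
    exact symbolAt_le O ρ _

/-- A finite set that contains the lists of terms of all representations in a wreath product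
`A ≀ B`, for `B` acting on `m` points and `A` acting on `n` points. -/
def termsBound (m n : ℕ) : Set (List ((ℕ × ℕ) × Multiset (ℕ × ℕ))) :=
  {T | T.length ≤ m ∧ ∀ t ∈ T, t ∈ Set.Iic (m, m) ×ˢ typeBound n}

theorem finite_termsBound (m n : ℕ) : (termsBound m n).Finite :=
  finite_setOf_list ((Set.finite_Iic _).prod (finite_typeBound n)) m

end Finiteness

section WreathMassFormulas

variable {K Ω : Type u} [Field K] [Field Ω] [Algebra K Ω] [IsSepClosure K Ω]
  {A B X Y : Type*} [Group A] [Group B] [MulAction A X] [Fintype X] [MulAction B Y]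
  [Fintype Y] [LinearOrder Y]

theorem wreathTerms_mem_termsBound (O : Subring K) (ρ : Rep K Ω (Wreath A B Y)) :
    wreathTerms X O ρ ∈ termsBound (Fintype.card Y) (Fintype.card X) := by
  constructor
  · rw [wreathTerms, List.length_map]
    exact (nodup_orbitReps _).length_le_card
  · intro t ht
    obtain ⟨i, -, rfl⟩ := List.mem_map.1 ht
    exact ⟨symbolAt_le O _ _, repType_mem_typeBound _ _⟩

/-- Lists describe the same wreath type if and only if they are related by `SameTerms`. -/
def wreathTypeSetoid : Setoid (List ((ℕ × ℕ) × Multiset (ℕ × ℕ))) where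
  r := SameTerms
  iseqv := ⟨SameTerms.refl, SameTerms.symm, SameTerms.trans⟩

/-- The wreath types of the representations of type `σ`, for `B` acting on `m` points and `A`
acting on `n` points; the bound by `termsBound` makes this a finite type. -/
abbrev WreathTypes (m n : ℕ) (σ : Multiset (ℕ × ℕ)) :=
  {q : Quotient wreathTypeSetoid // q ∈ Quotient.mk wreathTypeSetoid '' termsBound m n ∧
    totalType q.out = σ}

instance finite_wreathTypes (m n : ℕ) (σ : Multiset (ℕ × ℕ)) : Finite (WreathTypes m n σ) :=
  ((finite_termsBound m n).image _).subset fun _ h => h.1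

theorem hasWreathType_out_iff {O : Subring K} {ρ : Rep K Ω (Wreath A B Y)}
    {q : Quotient wreathTypeSetoid} :
    HasWreathType X O ρ q.out ↔ Quotient.mk wreathTypeSetoid (wreathTerms X O ρ) = q :=
  hasWreathType_iff_sameTerms.trans (Quotient.mk_eq_iff_out (s := wreathTypeSetoid)).symm

theorem HasWreathType.repType_eq {O : Subring K} {ρ : Rep K Ω (Wreath A B Y)}
    {T : List ((ℕ × ℕ) × Multiset (ℕ × ℕ))} (h : HasWreathType X O ρ T) :
    repType (Y × X) O ρ = totalType T := by
  rw [repType_eq_totalType_wreathTerms]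
  exact ((hasWreathType_iff_sameTerms.1 h).perm.map _).sum_eq

/-- The representations of a given type, sorted by their wreath types. -/
def sigmaWreathTypes (A B X Y : Type*) [Group A] [Group B] [MulAction A X] [Fintype X]
    [MulAction B Y] [Fintype Y] [LinearOrder Y] (Ω : Type u) [Field Ω] [Algebra K Ω]
    [IsSepClosure K Ω] (O : Subring K) (σ : Multiset (ℕ × ℕ)) :
    {ρ : Rep K Ω (Wreath A B Y) // repType (Y × X) O ρ = σ} ≃
      Σ q : WreathTypes (Fintype.card Y) (Fintype.card X) σ,
        {ρ : Rep K Ω (Wreath A B Y) // HasWreathType X O ρ q.1.out} where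
  toFun ρ := ⟨⟨Quotient.mk wreathTypeSetoid (wreathTerms X O ρ.1),
    ⟨_, wreathTerms_mem_termsBound O ρ.1, rfl⟩,
    (hasWreathType_out_iff.2 rfl).repType_eq.symm.trans ρ.2⟩, ⟨ρ.1, hasWreathType_out_iff.2 rfl⟩⟩
  invFun x := ⟨x.2.1, x.2.2.repType_eq.trans x.1.2.2⟩
  left_inv _ := rfl
  right_inv := by
    rintro ⟨⟨q, hq⟩, ⟨ρ, hρ⟩⟩
    obtain rfl := hasWreathType_out_iff.1 hρ
    rfl

/-- The polynomial of the mass formula for the wreath type `T`, where `a` stands for the order of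
`A`, `n` for the number of points on which `B` acts, and `fA`, `fB` for the polynomials of the mass
formulas of `A` and `B`. -/
def wreathPolynomial (a n : ℕ) (fA fB : Multiset (ℕ × ℕ) → Polynomial ℤ)
    (T : List ((ℕ × ℕ) × Multiset (ℕ × ℕ))) : Polynomial ℤ :=
  (a : Polynomial ℤ) ^ (n - T.length) * fB (Multiset.ofList (T.map Prod.fst)) *
    (T.map fun t => (fA t.2).comp (Polynomial.X ^ t.1.1)).prod

theorem aeval_inv_wreathPolynomial (q : ℝ) (a n : ℕ) (fA fB : Multiset (ℕ × ℕ) → Polynomial ℤ)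
    (T : List ((ℕ × ℕ) × Multiset (ℕ × ℕ))) :
    Polynomial.aeval q⁻¹ (wreathPolynomial a n fA fB T) =
      (a : ℝ) ^ (n - T.length) * Polynomial.aeval q⁻¹ (fB (Multiset.ofList (T.map Prod.fst))) *
        (T.map fun t => Polynomial.aeval (q ^ t.1.1)⁻¹ (fA t.2)).prod := by
  simp only [wreathPolynomial, map_mul, map_pow, map_natCast, map_list_prod, List.map_map,
    Function.comp_def, Polynomial.aeval_comp, Polynomial.aeval_X, inv_pow]

theorem hasMassFormulasByType_wreath [Finite A] {S : FieldClass.{u}} {cA : RepFunction.{u} A}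
    {cB : RepFunction.{u} B} (hS : ContainsPointFields S B Y)
    (hA : HasMassFormulasByType X S cA) (hB : HasMassFormulasByType Y S cB) :
    HasMassFormulasByType (Y × X) S (wreathCount Y cA cB) := by
  choose fA hA using hA
  choose fB hB using hB
  intro σ
  have := Fintype.ofFinite (WreathTypes (Fintype.card Y) (Fintype.card X) σ)
  refine ⟨∑ q : WreathTypes (Fintype.card Y) (Fintype.card X) σ,
    wreathPolynomial (Nat.card A) (Fintype.card Y) fA fB q.1.out, fun K Ω _ _ _ _ O hO hK => ?_⟩
  rw [← (sigmaWreathTypes A B X Y Ω O σ).symm.hasSum_iff, map_sum]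
  simp only [aeval_inv_wreathPolynomial]
  exact hasSum_sigma_of_nonneg (fun _ => inv_nonneg.2 (by positivity))
    (fun q => hasSum_wreathType hS hA hB hO hK q.1.out) (hasSum_fintype _)

end WreathMassFormulas

section DirectProducts

variable {K Ω : Type u} [Field K] [Field Ω] [Algebra K Ω]
  {A B X Y : Type*} [Group A] [Group B] [MulAction A X] [MulAction B Y]

/-- Representations in a direct product are pairs of representations. -/
def repProdEquiv (K Ω A B : Type*) [Field K] [Field Ω] [Algebra K Ω] [Group A] [Group B] :
    Rep K Ω (A × B) ≃ Rep K Ω A × Rep K Ω B where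
  toFun ρ := (ρ.map (MonoidHom.fst A B), ρ.map (MonoidHom.snd A B))
  invFun ρ := ⟨ρ.1.1.prod ρ.2.1, continuous_of_eventually_eq_one _
    (ρ.1.eventually_eq_one.and ρ.2.eventually_eq_one |>.mono fun _ h => Prod.ext h.1 h.2)⟩
  left_inv _ := rfl
  right_inv _ := rfl

theorem isOrbitTransversal_sumMap {ι κ : Type*} {ρ : Rep K Ω (A × B)} {F : ι → X} {G : κ → Y}
    (hF : IsOrbitTransversal (ρ.map (MonoidHom.fst A B)) F)
    (hG : IsOrbitTransversal (ρ.map (MonoidHom.snd A B)) G) :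
    IsOrbitTransversal ρ (Sum.map F G) := by
  rintro (x | y)
  · obtain ⟨i, hi, hi_unique⟩ := hF x
    obtain ⟨g, rfl⟩ := Rep.mem_orbit_range.1 hi
    refine ⟨.inl i, Rep.mem_orbit_range.2 ⟨g, rfl⟩, ?_⟩
    rintro (j | j) hj <;> obtain ⟨h, hh⟩ := Rep.mem_orbit_range.1 hj
    · exact congrArg _ (hi_unique j (Rep.mem_orbit_range.2 ⟨h, Sum.inl_injective hh⟩))
    · exact absurd hh Sum.inr_ne_inl
  · obtain ⟨i, hi, hi_unique⟩ := hG y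
    obtain ⟨g, rfl⟩ := Rep.mem_orbit_range.1 hi
    refine ⟨.inr i, Rep.mem_orbit_range.2 ⟨g, rfl⟩, ?_⟩
    rintro (j | j) hj <;> obtain ⟨h, hh⟩ := Rep.mem_orbit_range.1 hj
    · exact absurd hh Sum.inl_ne_inr
    · exact congrArg _ (hi_unique j (Rep.mem_orbit_range.2 ⟨h, Sum.inr_injective hh⟩))

theorem symbolAt_inl (O : Subring K) (ρ : Rep K Ω (A × B)) (x : X) :
    symbolAt O ρ (Sum.inl x : X ⊕ Y) = symbolAt O (ρ.map (MonoidHom.fst A B)) x := by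
  have stab_eq : ρ.stab (Sum.inl x : X ⊕ Y) = (ρ.map (MonoidHom.fst A B)).stab x :=
    Subgroup.ext fun g => Sum.inl_injective.eq_iff
  exact Prod.ext (by rw [symbolAt_fst, symbolAt_fst, stab_eq])
    (by rw [symbolAt_snd, symbolAt_snd, stab_eq])

theorem symbolAt_inr (O : Subring K) (ρ : Rep K Ω (A × B)) (y : Y) :
    symbolAt O ρ (Sum.inr y : X ⊕ Y) = symbolAt O (ρ.map (MonoidHom.snd A B)) y := by
  have stab_eq : ρ.stab (Sum.inr y : X ⊕ Y) = (ρ.map (MonoidHom.snd A B)).stab y :=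
    Subgroup.ext fun g => Sum.inr_injective.eq_iff
  exact Prod.ext (by rw [symbolAt_fst, symbolAt_fst, stab_eq])
    (by rw [symbolAt_snd, symbolAt_snd, stab_eq])

variable [Fintype X] [Fintype Y]

theorem repType_sum (O : Subring K) (ρ : Rep K Ω (A × B)) : repType (X ⊕ Y) O ρ =
    repType X O (ρ.map (MonoidHom.fst A B)) + repType Y O (ρ.map (MonoidHom.snd A B)) := by
  classical
  have transversal_fst := isOrbitTransversal_out (X := X) (ρ.map (MonoidHom.fst A B))
  have transversal_snd := isOrbitTransversal_out (X := Y) (ρ.map (MonoidHom.snd A B))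
  rw [(isOrbitTransversal_sumMap transversal_fst transversal_snd).repType_eq,
    transversal_fst.repType_eq, transversal_snd.repType_eq, Fintype.sum_sum_type]
  simp only [Sum.map_inl, Sum.map_inr, symbolAt_inl, symbolAt_inr]

theorem HasProductType.repType_eq {O : Subring K} {ρ : Rep K Ω (A × B)} {σ τ : Multiset (ℕ × ℕ)}
    (h : HasProductType X Y O ρ σ τ) : repType (X ⊕ Y) O ρ = σ + τ := by
  rw [repType_sum, h.1, h.2]

/-- Representations of product type `(σ, τ)` are pairs of a representation of type `σ` and one of
type `τ`. -/
def productTypeEquiv (A B X Y : Type*) [Group A] [Group B] [MulAction A X] [MulAction B Y]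
    [Fintype X] [Fintype Y] (O : Subring K) (σ τ : Multiset (ℕ × ℕ)) :
    {ρ : Rep K Ω (A × B) // HasProductType X Y O ρ σ τ} ≃
      {ρ : Rep K Ω A // repType X O ρ = σ} × {ρ : Rep K Ω B // repType Y O ρ = τ} :=
  ((repProdEquiv K Ω A B).subtypeEquiv fun _ => Iff.rfl).trans
    (Equiv.subtypeProdEquivProd (p := fun ρ : Rep K Ω A => repType X O ρ = σ)
      (q := fun ρ : Rep K Ω B => repType Y O ρ = τ))

/-- The representations of a given type, sorted by their product types. -/
def sigmaProductTypes (A B X Y : Type*) [Group A] [Group B] [MulAction A X] [MulAction B Y]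
    [Fintype X] [Fintype Y] (Ω : Type u) [Field Ω] [Algebra K Ω] (O : Subring K)
    (σ : Multiset (ℕ × ℕ)) :
    {ρ : Rep K Ω (A × B) // repType (X ⊕ Y) O ρ = σ} ≃
      Σ p : {p : Multiset (ℕ × ℕ) × Multiset (ℕ × ℕ) // p.1 + p.2 = σ},
        {ρ : Rep K Ω (A × B) // HasProductType X Y O ρ p.1.1 p.1.2} where
  toFun ρ := ⟨⟨(repType X O (ρ.1.map (MonoidHom.fst A B)),
    repType Y O (ρ.1.map (MonoidHom.snd A B))), (repType_sum O ρ.1).symm.trans ρ.2⟩,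
    ⟨ρ.1, rfl, rfl⟩⟩
  invFun x := ⟨x.2.1, x.2.2.repType_eq.trans x.1.2⟩
  left_inv _ := rfl
  right_inv := by
    rintro ⟨⟨⟨σ, τ⟩, h⟩, ⟨ρ, hρ⟩⟩
    obtain ⟨rfl, rfl⟩ : repType X O _ = σ ∧ repType Y O _ = τ := hρ
    rfl

variable [IsSepClosure K Ω]

theorem hasSum_productType {S : FieldClass.{u}} {cA : RepFunction.{u} A} {cB : RepFunction.{u} B}
    {σ τ : Multiset (ℕ × ℕ)} {f g : Polynomial ℤ} (hA : IsMassFormula X S cA σ f)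
    (hB : IsMassFormula Y S cB τ g) {O : Subring K} (hO : IsLocalField K O) (hK : S K O) :
    HasSum (fun ρ : {ρ : Rep K Ω (A × B) // HasProductType X Y O ρ σ τ} =>
        ((residueCard O : ℝ) ^ prodCount cA cB K Ω O ρ.1)⁻¹)
      (Polynomial.aeval (residueCard O : ℝ)⁻¹ f * Polynomial.aeval (residueCard O : ℝ)⁻¹ g) := by
  have h := hasSum_prod_mul (hA K Ω O hO hK) (hB K Ω O hO hK)
  simp only [← mul_inv, ← pow_add] at h
  exact (productTypeEquiv A B X Y O σ τ).hasSum_iff.2 h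

theorem hasMassFormulasByType_prod {S : FieldClass.{u}} {cA : RepFunction.{u} A}
    {cB : RepFunction.{u} B} (hA : HasMassFormulasByType X S cA)
    (hB : HasMassFormulasByType Y S cB) :
    HasMassFormulasByType (X ⊕ Y) S (prodCount cA cB) := by
  choose fA hA using hA
  choose fB hB using hB
  intro σ
  have : Finite {p : Multiset (ℕ × ℕ) × Multiset (ℕ × ℕ) // p.1 + p.2 = σ} :=
    (Multiset.antidiagonal σ).toFinset.finite_toSet.subset
      fun p (hp : p.1 + p.2 = σ) => by simpa using hp
  have := Fintype.ofFinite {p : Multiset (ℕ × ℕ) × Multiset (ℕ × ℕ) // p.1 + p.2 = σ}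
  refine ⟨∑ p : {p : Multiset (ℕ × ℕ) × Multiset (ℕ × ℕ) // p.1 + p.2 = σ},
    fA p.1.1 * fB p.1.2, fun K Ω _ _ _ _ O hO hK => ?_⟩
  rw [← (sigmaProductTypes A B X Y Ω O σ).symm.hasSum_iff, map_sum]
  simp only [map_mul]
  exact hasSum_sigma_of_nonneg (fun _ => inv_nonneg.2 (by positivity))
    (fun p => hasSum_productType (hA p.1.1) (hB p.1.2) hO hK) (hasSum_fintype _)

end DirectProducts

end MassFormula

end

theorem theorem2_general {A B X Y : Type*} [Group A] [Group B]
    [Fintype X] [MulAction A X] [Fintype Y] [LinearOrder Y] [MulAction B Y]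
    (S : MassFormula.FieldClass.{u})
    (cA : MassFormula.RepFunction.{u} A) (cB : MassFormula.RepFunction.{u} B)
    (hcA : MassFormula.IsCountingFunction cA) (hcB : MassFormula.IsCountingFunction cB)
    (hA : MassFormula.HasMassFormulasByType X S cA)
    (hB : MassFormula.HasMassFormulasByType Y S cB) :
    (MassFormula.IsCountingFunction (MassFormula.wreathCount Y cA cB) ∧
      (Finite A → MassFormula.ContainsPointFields S B Y →
        MassFormula.HasMassFormulasByType (Y × X) S (MassFormula.wreathCount Y cA cB) ∧
        ∀ fA fB : Multiset (ℕ × ℕ) → Polynomial ℤ,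
          (∀ σ, MassFormula.IsMassFormula X S cA σ (fA σ)) →
          (∀ σ, MassFormula.IsMassFormula Y S cB σ (fB σ)) →
          ∀ (T : List ((ℕ × ℕ) × Multiset (ℕ × ℕ)))
            (K Ω : Type u) [Field K] [Field Ω] [Algebra K Ω] [IsSepClosure K Ω] (O : Subring K),
            MassFormula.IsLocalField K O → S K O →
            HasSum
              (fun ρ : {ρ : MassFormula.Rep K Ω (MassFormula.Wreath A B Y) //
                  MassFormula.HasWreathType X O ρ T} =>
                ((MassFormula.residueCard O : ℝ) ^
                  MassFormula.wreathCount Y cA cB K Ω O ρ.1)⁻¹)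
              ((Nat.card A : ℝ) ^ (Fintype.card Y - T.length) *
                Polynomial.aeval ((MassFormula.residueCard O : ℝ)⁻¹)
                  (fB (Multiset.ofList (T.map Prod.fst))) *
                (T.map fun t =>
                  Polynomial.aeval (((MassFormula.residueCard O : ℝ) ^ t.1.1)⁻¹) (fA t.2)).prod))) ∧
    (MassFormula.IsCountingFunction (MassFormula.prodCount cA cB) ∧
      MassFormula.HasMassFormulasByType (X ⊕ Y) S (MassFormula.prodCount cA cB) ∧
      ∀ fA fB : Multiset (ℕ × ℕ) → Polynomial ℤ,
        (∀ σ, MassFormula.IsMassFormula X S cA σ (fA σ)) →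
        (∀ σ, MassFormula.IsMassFormula Y S cB σ (fB σ)) →
        ∀ (σ τ : Multiset (ℕ × ℕ))
          (K Ω : Type u) [Field K] [Field Ω] [Algebra K Ω] [IsSepClosure K Ω] (O : Subring K),
          MassFormula.IsLocalField K O → S K O →
          HasSum
            (fun ρ : {ρ : MassFormula.Rep K Ω (A × B) // MassFormula.HasProductType X Y O ρ σ τ} =>
              ((MassFormula.residueCard O : ℝ) ^ MassFormula.prodCount cA cB K Ω O ρ.1)⁻¹)
            (Polynomial.aeval ((MassFormula.residueCard O : ℝ)⁻¹) (fA σ) *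
              Polynomial.aeval ((MassFormula.residueCard O : ℝ)⁻¹) (fB τ))) :=
  ⟨⟨MassFormula.isCountingFunction_wreathCount hcA hcB, fun _ hS =>
      ⟨MassFormula.hasMassFormulasByType_wreath hS hA hB, fun _ _ hfA hfB T _ _ _ _ _ _ _ hO hK =>
        MassFormula.hasSum_wreathType hS hfA hfB hO hK T⟩⟩,
    MassFormula.isCountingFunction_prodCount hcA hcB, MassFormula.hasMassFormulasByType_prod hA hB,
    fun _ _ hfA hfB σ τ _ _ _ _ _ _ _ hO hK =>
      MassFormula.hasSum_productType (hfA σ) (hfB τ) hO hK⟩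

theorem theorem2 {A B X Y : Type*} [Group A] [Finite A] [Group B] [Finite B]
    [Fintype X] [MulAction A X] [Fintype Y] [LinearOrder Y] [MulAction B Y]
    (S : MassFormula.FieldClass.{u})
    (cA : MassFormula.RepFunction.{u} A) (cB : MassFormula.RepFunction.{u} B)
    (hcA : MassFormula.IsCountingFunction cA) (hcB : MassFormula.IsCountingFunction cB)
    (hA : MassFormula.HasMassFormulasByType X S cA)
    (hB : MassFormula.HasMassFormulasByType Y S cB) :
    -- wreath products
    (MassFormula.IsCountingFunction (MassFormula.wreathCount Y cA cB) ∧
      (MassFormula.ContainsPointFields S B Y →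
        MassFormula.HasMassFormulasByType (Y × X) S (MassFormula.wreathCount Y cA cB) ∧
        ∀ fA fB : Multiset (ℕ × ℕ) → Polynomial ℤ,
          (∀ σ, MassFormula.IsMassFormula X S cA σ (fA σ)) →
          (∀ σ, MassFormula.IsMassFormula Y S cB σ (fB σ)) →
          ∀ (T : List ((ℕ × ℕ) × Multiset (ℕ × ℕ)))
            (K Ω : Type u) [Field K] [Field Ω] [Algebra K Ω] [IsSepClosure K Ω] (O : Subring K),
            MassFormula.IsLocalField K O → S K O →
            HasSum
              (fun ρ : {ρ : MassFormula.Rep K Ω (MassFormula.Wreath A B Y) //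
                  MassFormula.HasWreathType X O ρ T} =>
                ((MassFormula.residueCard O : ℝ) ^
                  MassFormula.wreathCount Y cA cB K Ω O ρ.1)⁻¹)
              ((Nat.card A : ℝ) ^ (Fintype.card Y - T.length) *
                Polynomial.aeval ((MassFormula.residueCard O : ℝ)⁻¹)
                  (fB (Multiset.ofList (T.map Prod.fst))) *
                (T.map fun t =>
                  Polynomial.aeval (((MassFormula.residueCard O : ℝ) ^ t.1.1)⁻¹) (fA t.2)).prod))) ∧
    -- direct products
    (MassFormula.IsCountingFunction (MassFormula.prodCount cA cB) ∧
      MassFormula.HasMassFormulasByType (X ⊕ Y) S (MassFormula.prodCount cA cB) ∧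
      ∀ fA fB : Multiset (ℕ × ℕ) → Polynomial ℤ,
        (∀ σ, MassFormula.IsMassFormula X S cA σ (fA σ)) →
        (∀ σ, MassFormula.IsMassFormula Y S cB σ (fB σ)) →
        ∀ (σ τ : Multiset (ℕ × ℕ))
          (K Ω : Type u) [Field K] [Field Ω] [Algebra K Ω] [IsSepClosure K Ω] (O : Subring K),
          MassFormula.IsLocalField K O → S K O →
          HasSum
            (fun ρ : {ρ : MassFormula.Rep K Ω (A × B) // MassFormula.HasProductType X Y O ρ σ τ} =>
              ((MassFormula.residueCard O : ℝ) ^ MassFormula.prodCount cA cB K Ω O ρ.1)⁻¹)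
            (Polynomial.aeval ((MassFormula.residueCard O : ℝ)⁻¹) (fA σ) *
              Polynomial.aeval ((MassFormula.residueCard O : ℝ)⁻¹) (fB τ))) := by
  have general := theorem2_general S cA cB hcA hcB hA hB
  exact ⟨⟨general.1.1, general.1.2 ‹_›⟩, general.2⟩
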